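/- **Setting.** Let $X$ be a complex Banach space and $\mathcal L(X)$ the algebra of bounded operators on $X$. *Functions.* $\varphi\in\mathcal{OM}_-$ (negative complete Bernstein) means that $\varphi$ is holomorphic in $\mathbb C\setminus[0,\infty)$, $\operatorname{Im} w\,\operatorname{Im}\varphi(w)\ge 0$ for all $w\in\mathbb C\setminus[0,\infty)$, and the limit $\varphi(-0)=\lim_{x\to0-}\varphi(x)$ exists and is real. Such a function has a unique representation $$\varphi(z)=c+bz+\int_{(0,\infty)}\frac{z}{t-z}\,d\mu(t),\qquad z\in\mathbb C\setminus[0,\infty),$$ with $c\in\mathbb R$, $b\ge0$ and a positive measure $\mu$ on $(0,\infty)$ with $\int_{(0,\infty)}\frac{d\mu(t)}{1+t}<\infty$. Put $\varphi'(-0)=\lim_{x\to0-}\varphi'(x)\in[0,\infty]$. *Operators.* A closed, densely defined linear operator $A:D(A)\subseteq X\to X$ is nonpositive, $A\in\mathcal{NP}(X)$, if $(0,\infty)\subseteq\rho(A)$ and $M_A:=\sup_{t>0}\|tR(t,A)\|<\infty$, where $R(t,A)=(tI-A)^{-1}$. For $\varphi\in\mathcal{OM}_-$ and $A\in\mathcal{NP}(X)$,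 $\varphi(A)$ denotes the closure of the (closable) operator $$x\mapsto cx+bAx+\int_{(0,\infty)}AR(t,A)x\,d\mu(t),\qquad x\in D(A).$$ *Ideals.* An operator ideal $(\mathcal I,\|\cdot\|_{\mathcal I})$ in $X$ is a two-sided ideal $\mathcal I$ of $\mathcal L(X)$ which is complete with respect to the norm $\|\cdot\|_{\mathcal I}$ and satisfies $\|PSQ\|_{\mathcal I}\le\|P\|\,\|S\|_{\mathcal I}\,\|Q\|$ and $\|S\|\le\|S\|_{\mathcal I}$ for all $P,Q\in\mathcal L(X)$, $S\in\mathcal I$. A densely defined operator is said to belong to $\mathcal I$ if it is bounded and its unique continuous extension to $X$ belongs to $\mathcal I$; it is then identified with that extension. **Proposition 3.6.** Let $\mathcal I$ be an operator ideal in $X$ and let $\varphi\in\mathcal{OM}_-$ with $\varphi'(-0)<\infty$. For any $A,B\in\mathcal{NP}(X)$ such that $D(A)\subseteq D(B)$ and $A-B$ belongs to $\mathcal I$, the operator $\varphi(A)-\varphi(B)$ (with domain $D(\varphi(A))\cap D(\varphi(B))$) also belongs to $\mathcal I$, and $$\|\varphi(A)-\varphi(B)\|_{\mathcal I}\le M_AM_B\,\varphi'(-0)\,\|A-B\|_{\mathcal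 I}.$$ -/

import Mathlib

open Set Filter Topology MeasureTheory

noncomputable section

namespace HirschCalculus

/-! ### Complete Bernstein functions on the negative half-line -/

/-- The class of negative complete Bernstein functions: `φ` is holomorphic in `ℂ \ [0, ∞)`,
satisfies `Im w * Im φ(w) ≥ 0` there, and its limit at `0` from the left along the real axis
exists and is real. Only the values of `φ` on `ℂ \ [0, ∞)` matter. -/
structure IsNegCompleteBernstein (φ : ℂ → ℂ) : Prop where
  differentiableOn : DifferentiableOn ℂ φ (Complex.ofReal '' Ici 0)ᶜ
  im_mul_im_nonneg : ∀ w ∈ (Complex.ofReal '' Ici 0)ᶜ, 0 ≤ w.im * (φ w).im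
  exists_limit : ∃ c : ℝ, Tendsto (fun x : ℝ => φ (x : ℂ)) (𝓝[<] 0) (𝓝 (c : ℂ))

/-- `d` is the (finite) value of `φ'(-0)`, the limit of `φ'(x)` as the real variable `x` tends
to `0` from the left. -/
def HasDerivLimit (φ : ℂ → ℂ) (d : ℝ) : Prop :=
  Tendsto (fun x : ℝ => deriv φ (x : ℂ)) (𝓝[<] 0) (𝓝 (d : ℂ))

/-- A triple `(c, b, μ)` as in the integral representation of negative complete Bernstein
functions: `c` is real, `b ≥ 0`, and `μ` is a positive measure on `(0, ∞)` with
`∫ dμ(t) / (1 + t) < ∞`. (The measure is given on `ℝ`; only its restriction to `(0, ∞)` is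
ever used.) -/
structure ReprTriple where
  c : ℝ
  b : ℝ
  μ : Measure ℝ
  b_nonneg : 0 ≤ b
  integrableOn : IntegrableOn (fun t : ℝ => (1 + t)⁻¹) (Ioi 0) μ

/-- `φ(z) = c + b z + ∫_{(0, ∞)} z / (t - z) dμ(t)` on `ℂ \ [0, ∞)`. -/
def ReprTriple.Represents (σ : ReprTriple) (φ : ℂ → ℂ) : Prop :=
  ∀ z ∈ (Complex.ofReal '' Ici 0)ᶜ,
    φ z = σ.c + σ.b * z + ∫ t in Ioi (0 : ℝ), z / ((t : ℂ) - z) ∂σ.μ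

open scoped Classical in
/-- The representing triple of `φ`. It exists for every negative complete Bernstein function,
and then `c`, `b` and the restriction of `μ` to `(0, ∞)` are unique; for other functions the
value is the zero triple. -/
def reprTriple (φ : ℂ → ℂ) : ReprTriple :=
  if h : ∃ σ : ReprTriple, σ.Represents φ then h.choose
  else ⟨0, 0, 0, le_rfl, by simp [IntegrableOn]⟩

/-! ### Unbounded operators, resolvents, nonpositive operators -/

variable {X : Type*} [NormedAddCommGroup X] [NormedSpace ℂ X]

/-- The bounded operator `R` is a two-sided inverse of `z I - A : D(A) → X`. -/
def IsResolventAt (A : X →ₗ.[ℂ] X) (z : ℂ) (R : X →L[ℂ] X) : Prop :=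
  (∀ x : X, ∃ h : R x ∈ A.domain, z • R x - A ⟨R x, h⟩ = x) ∧
    ∀ y : A.domain, R (z • (y : X) - A y) = y

/-- The resolvent set `ρ(A)`. -/
def resolventSet (A : X →ₗ.[ℂ] X) : Set ℂ := {z | ∃ R, IsResolventAt A z R}

open scoped Classical in
/-- The resolvent `R(z, A) = (z I - A)⁻¹`; by convention `0` if `z ∉ ρ(A)`. -/
def resolvent (A : X →ₗ.[ℂ] X) (z : ℂ) : X →L[ℂ] X :=
  if h : ∃ R, IsResolventAt A z R then h.choose else 0

/-- A nonpositive operator: closed, densely defined, `(0, ∞) ⊆ ρ(A)`, and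
`sup_{t > 0} ‖t R(t, A)‖ < ∞`. -/
structure IsNonpositive (A : X →ₗ.[ℂ] X) : Prop where
  isClosed : A.IsClosed
  dense_domain : Dense (A.domain : Set X)
  mem_resolventSet : ∀ t : ℝ, 0 < t → (t : ℂ) ∈ resolventSet A
  bddAbove : BddAbove (range fun t : Ioi (0 : ℝ) => ‖((t : ℝ) : ℂ) • resolvent A ((t : ℝ) : ℂ)‖)

/-- The constant `M_A = sup_{t > 0} ‖t R(t, A)‖`. -/
def resolventBound (A : X →ₗ.[ℂ] X) : ℝ :=
  ⨆ t : Ioi (0 : ℝ), ‖((t : ℝ) : ℂ) • resolvent A ((t : ℝ) : ℂ)‖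

open scoped Classical in
/-- `A y` for `y ∈ D(A)`, and `0` for `y ∉ D(A)`. -/
def applyOrZero (A : X →ₗ.[ℂ] X) (y : X) : X :=
  if h : y ∈ A.domain then A ⟨y, h⟩ else 0

/-- The densely defined operator `T` is bounded, and the bounded operator `S` on `X` is its
(unique) continuous extension. In this sense `T` is identified with `S`. -/
def IsBoundedExtension (T : X →ₗ.[ℂ] X) (S : X →L[ℂ] X) : Prop :=
  Dense (T.domain : Set X) ∧ ∀ x : T.domain, T x = S x

theorem resolvent_spec {A : X →ₗ.[ℂ] X} {z : ℂ} (hz : z ∈ resolventSet A) :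
    IsResolventAt A z (resolvent A z) := by
  have h : ∃ R, IsResolventAt A z R := hz
  rw [resolvent, dif_pos h]
  exact h.choose_spec

namespace IsNonpositive

variable {A : X →ₗ.[ℂ] X}

theorem spec (hA : IsNonpositive A) {t : ℝ} (ht : 0 < t) :
    IsResolventAt A t (resolvent A t) :=
  resolvent_spec (hA.mem_resolventSet t ht)

theorem resolventBound_nonneg (A : X →ₗ.[ℂ] X) : 0 ≤ resolventBound A :=
  Real.iSup_nonneg fun _ => norm_nonneg _

theorem norm_resolvent_le (hA : IsNonpositive A) {t : ℝ} (ht : 0 < t) :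
    ‖resolvent A (t : ℂ)‖ ≤ resolventBound A / t := by
  have h := le_ciSup hA.bddAbove ⟨t, ht⟩
  simp only [norm_smul, Complex.norm_real, Real.norm_eq_abs, abs_of_pos ht] at h
  rw [le_div_iff₀ ht, mul_comm, resolventBound]
  simpa only [norm_smul, Complex.norm_real, Real.norm_eq_abs] using h

theorem norm_resolvent_apply_le (hA : IsNonpositive A) {t : ℝ} (ht : 0 < t) (x : X) :
    ‖resolvent A (t : ℂ) x‖ ≤ resolventBound A / t * ‖x‖ :=
  (ContinuousLinearMap.le_opNorm _ _).trans
    (mul_le_mul_of_nonneg_right (hA.norm_resolvent_le ht) (norm_nonneg _))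

/-- `A R(t, A) = t R(t, A) - I`. -/
theorem applyOrZero_resolvent (hA : IsNonpositive A) {t : ℝ} (ht : 0 < t) (x : X) :
    applyOrZero A (resolvent A (t : ℂ) x) = (t : ℂ) • resolvent A (t : ℂ) x - x := by
  obtain ⟨h, h'⟩ := (hA.spec ht).1 x
  rw [applyOrZero, dif_pos h]
  nth_rewrite 3 [← h']
  abel

/-- `A R(t, A) x = R(t, A) A x` for `x ∈ D(A)`. -/
theorem applyOrZero_resolvent_of_mem (hA : IsNonpositive A) {t : ℝ} (ht : 0 < t)
    (x : A.domain) :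
    applyOrZero A (resolvent A (t : ℂ) x) = resolvent A (t : ℂ) (A x) := by
  have h := (hA.spec ht).2 x
  rw [map_sub, map_smul] at h
  rw [hA.applyOrZero_resolvent ht]
  nth_rewrite 2 [← h]
  abel

/-- The resolvent identity. -/
theorem resolvent_sub (hA : IsNonpositive A) {s t : ℝ} (hs : 0 < s) (ht : 0 < t) (x : X) :
    resolvent A (s : ℂ) x - resolvent A (t : ℂ) x =
      ((t : ℂ) - s) • resolvent A (s : ℂ) (resolvent A (t : ℂ) x) := by
  obtain ⟨h, h'⟩ := (hA.spec ht).1 x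
  have h2 := (hA.spec hs).2 ⟨_, h⟩
  rw [← map_smul]
  nth_rewrite 1 [← h']
  rw [show ∀ u : X, u - resolvent A (t : ℂ) x = u - resolvent A (s : ℂ)
    ((s : ℂ) • resolvent A (t : ℂ) x - A ⟨resolvent A (t : ℂ) x, h⟩) from
      fun u => congrArg (u - ·) h2.symm, ← map_sub]
  congr 1
  simp only [sub_smul]
  abel

theorem resolvent_comm (hA : IsNonpositive A) {s t : ℝ} (hs : 0 < s) (ht : 0 < t) (x : X) :
    resolvent A (s : ℂ) (resolvent A (t : ℂ) x) =
      resolvent A (t : ℂ) (resolvent A (s : ℂ) x) := by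
  by_cases hst : s = t
  · rw [hst]
  have h0 : (t : ℂ) - s ≠ 0 := by
    rw [sub_ne_zero]
    exact_mod_cast Ne.symm hst
  have h1 := hA.resolvent_sub hs ht x
  have h2 := hA.resolvent_sub ht hs x
  have h3 : ((t : ℂ) - s) • resolvent A (s : ℂ) (resolvent A (t : ℂ) x) =
      ((t : ℂ) - s) • resolvent A (t : ℂ) (resolvent A (s : ℂ) x) := by
    rw [← h1, ← neg_sub (s : ℂ) t, neg_smul, ← h2]
    abel
  exact smul_right_injective X h0 h3

theorem continuousOn_resolvent (hA : IsNonpositive A) (x : X) :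
    ContinuousOn (fun t : ℝ => resolvent A (t : ℂ) x) (Ioi 0) := by
  intro t ht
  have ht' : (0 : ℝ) < t := ht
  rw [ContinuousWithinAt, tendsto_iff_norm_sub_tendsto_zero]
  have hlim : Tendsto (fun s : ℝ => |t - s| * (resolventBound A / s * ‖resolvent A (t : ℂ) x‖))
      (𝓝[Ioi 0] t) (𝓝 (|t - t| * (resolventBound A / t * ‖resolvent A (t : ℂ) x‖))) := by
    refine Tendsto.mono_left ?_ nhdsWithin_le_nhds
    refine ContinuousAt.tendsto (f := fun s : ℝ =>
      |t - s| * (resolventBound A / s * ‖resolvent A (t : ℂ) x‖)) ?_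
    have : t ≠ 0 := ht'.ne'
    fun_prop (disch := assumption)
  rw [sub_self, abs_zero, zero_mul] at hlim
  refine squeeze_zero' (Eventually.of_forall fun _ => norm_nonneg _) ?_ hlim
  filter_upwards [self_mem_nhdsWithin] with s hs
  have hs' : (0 : ℝ) < s := hs
  rw [hA.resolvent_sub hs' ht', norm_smul]
  refine mul_le_mul (le_of_eq ?_) (hA.norm_resolvent_apply_le hs' _) (norm_nonneg _)
    (abs_nonneg _)
  rw [← Complex.ofReal_sub, Complex.norm_real, Real.norm_eq_abs]

/-- The integral `∫_{(0, ∞)} A R(t, A) x dμ(t)` converges absolutely for `x ∈ D(A)`. -/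
theorem integrableOn_applyOrZero (hA : IsNonpositive A) (σ : ReprTriple) (x : A.domain) :
    IntegrableOn (fun t : ℝ => applyOrZero A (resolvent A (t : ℂ) x)) (Ioi 0) σ.μ := by
  have hcont : ContinuousOn (fun t : ℝ => applyOrZero A (resolvent A (t : ℂ) x)) (Ioi 0) := by
    have h : ContinuousOn (fun t : ℝ => (t : ℂ) • resolvent A (t : ℂ) (x : X) - x) (Ioi 0) :=
      ((Complex.continuous_ofReal.continuousOn).smul (hA.continuousOn_resolvent x)).sub
        continuousOn_const
    exact h.congr fun t ht => hA.applyOrZero_resolvent ht x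
  set M := resolventBound A with hM
  have hM0 : 0 ≤ M := resolventBound_nonneg A
  refine Integrable.mono' (σ.integrableOn.const_mul (2 * ((M + 1) * ‖(x : X)‖ + M * ‖A x‖)))
    (hcont.aestronglyMeasurable measurableSet_Ioi) ?_
  rw [ae_restrict_iff' measurableSet_Ioi]
  refine Eventually.of_forall fun t ht => ?_
  have ht' : (0 : ℝ) < t := ht
  have h1 : ‖applyOrZero A (resolvent A (t : ℂ) x)‖ ≤ (M + 1) * ‖(x : X)‖ := by
    rw [hA.applyOrZero_resolvent ht']
    refine (norm_sub_le _ _).trans ?_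
    rw [norm_smul, Complex.norm_real, Real.norm_eq_abs, abs_of_pos ht']
    have := mul_le_mul_of_nonneg_left (hA.norm_resolvent_apply_le ht' (x : X)) ht'.le
    have h2 : t * (resolventBound A / t * ‖(x : X)‖) = M * ‖(x : X)‖ := by
      rw [hM]; field_simp
    linarith
  have h2 : t * ‖applyOrZero A (resolvent A (t : ℂ) x)‖ ≤ M * ‖A x‖ := by
    rw [hA.applyOrZero_resolvent_of_mem ht']
    have := mul_le_mul_of_nonneg_left (hA.norm_resolvent_apply_le ht' (A x)) ht'.le
    have h2 : t * (resolventBound A / t * ‖A x‖) = M * ‖A x‖ := by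
      rw [hM]; field_simp
    linarith
  have h0 : 0 ≤ (M + 1) * ‖(x : X)‖ + M * ‖A x‖ := by positivity
  rw [← div_eq_mul_inv, le_div_iff₀ (by linarith)]
  linarith

end IsNonpositive

/-! ### The functional calculus -/

variable [CompleteSpace X]

/-- The operator `x ↦ c x + b A x + ∫_{(0, ∞)} A R(t, A) x dμ(t)` with domain `D(A)`. -/
def hirschCore (σ : ReprTriple) (A : X →ₗ.[ℂ] X) (hA : IsNonpositive A) : X →ₗ.[ℂ] X where
  domain := A.domain
  toFun :=
    { toFun := fun x => (σ.c : ℂ) • (x : X) + (σ.b : ℂ) • A x +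
        ∫ t in Ioi (0 : ℝ), applyOrZero A (resolvent A (t : ℂ) x) ∂σ.μ
      map_add' := fun x y => by
        have h : ∫ t in Ioi (0 : ℝ), applyOrZero A (resolvent A (t : ℂ) ↑(x + y)) ∂σ.μ =
            ∫ t in Ioi (0 : ℝ), (applyOrZero A (resolvent A (t : ℂ) x) +
              applyOrZero A (resolvent A (t : ℂ) y)) ∂σ.μ :=
          setIntegral_congr_fun measurableSet_Ioi fun t ht => by
            simp only [hA.applyOrZero_resolvent_of_mem ht, LinearPMap.map_add, map_add]
        rw [h, integral_add (hA.integrableOn_applyOrZero σ x) (hA.integrableOn_applyOrZero σ y)]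
        simp only [Submodule.coe_add, LinearPMap.map_add, smul_add]
        abel
      map_smul' := fun a x => by
        have h : ∫ t in Ioi (0 : ℝ), applyOrZero A (resolvent A (t : ℂ) ↑(a • x)) ∂σ.μ =
            ∫ t in Ioi (0 : ℝ), a • applyOrZero A (resolvent A (t : ℂ) x) ∂σ.μ :=
          setIntegral_congr_fun measurableSet_Ioi fun t ht => by
            simp only [hA.applyOrZero_resolvent_of_mem ht, LinearPMap.map_smul, map_smul]
        rw [h, integral_smul]
        simp only [Submodule.coe_smul, LinearPMap.map_smul, smul_add, RingHom.id_apply]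
        rw [smul_comm a (σ.c : ℂ), smul_comm a (σ.b : ℂ)] }

/-- The operator `x ↦ c x + b A x + ∫_{(0, ∞)} A R(t, A) x dμ(t)` on `D(A)` is closable. -/
theorem hirschCore_isClosable (σ : ReprTriple) (A : X →ₗ.[ℂ] X) (hA : IsNonpositive A) :
    (hirschCore σ A hA).IsClosable := by
  set R := resolvent A ((1 : ℝ) : ℂ) with hR
  have h1 : (0 : ℝ) < 1 := one_pos
  set M := resolventBound A with hM
  have hM0 : 0 ≤ M := IsNonpositive.resolventBound_nonneg A
  have hRx : ∀ x : X, ‖R x‖ ≤ M * ‖x‖ := fun x => by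
    have := hA.norm_resolvent_apply_le h1 x
    rwa [div_one] at this
  have hRA : ∀ x : A.domain, R (A x) = R x - x := fun x => by
    have := (hA.spec h1).2 x
    rw [map_sub, Complex.ofReal_one, one_smul] at this
    rw [← Complex.ofReal_one] at this
    rw [← hR] at this
    exact sub_eq_iff_eq_add.1 this |> fun e => by rw [e]; abel
  have hRAn : ∀ x : A.domain, ‖R (A x)‖ ≤ (M + 1) * ‖(x : X)‖ := fun x => by
    rw [hRA]
    refine (norm_sub_le _ _).trans ?_
    linarith [hRx x]
  set I := ∫ t in Ioi (0 : ℝ), (1 + t)⁻¹ ∂σ.μ with hI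
  obtain ⟨C, hC⟩ : ∃ C : ℝ, ∀ x : A.domain, ‖R (hirschCore σ A hA x)‖ ≤ C * ‖(x : X)‖ := by
    refine ⟨|σ.c| * M + |σ.b| * (M + 1) + 2 * (M * (M + 1)) * I, fun x => ?_⟩
    have hval : R (hirschCore σ A hA x) = (σ.c : ℂ) • R x + (σ.b : ℂ) • R (A x) +
        ∫ t in Ioi (0 : ℝ), R (applyOrZero A (resolvent A (t : ℂ) x)) ∂σ.μ := by
      rw [R.integral_comp_comm (hA.integrableOn_applyOrZero σ x)]
      change R ((σ.c : ℂ) • (x : X) + (σ.b : ℂ) • A x + _) = _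
      rw [map_add, map_add, map_smul, map_smul]
    have hint : ‖∫ t in Ioi (0 : ℝ), R (applyOrZero A (resolvent A (t : ℂ) x)) ∂σ.μ‖ ≤
        2 * (M * (M + 1)) * ‖(x : X)‖ * I := by
      rw [hI, ← integral_const_mul]
      refine norm_integral_le_of_norm_le (σ.integrableOn.const_mul _) ?_
      rw [ae_restrict_iff' measurableSet_Ioi]
      refine Eventually.of_forall fun t ht => ?_
      have ht' : (0 : ℝ) < t := ht
      have e1 : ‖R (applyOrZero A (resolvent A (t : ℂ) x))‖ ≤ M * ((M + 1) * ‖(x : X)‖) := by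
        refine (hRx _).trans (mul_le_mul_of_nonneg_left ?_ hM0)
        rw [hA.applyOrZero_resolvent ht']
        refine (norm_sub_le _ _).trans ?_
        rw [norm_smul, Complex.norm_real, Real.norm_eq_abs, abs_of_pos ht']
        have := mul_le_mul_of_nonneg_left (hA.norm_resolvent_apply_le ht' (x : X)) ht'.le
        have h2 : t * (resolventBound A / t * ‖(x : X)‖) = M * ‖(x : X)‖ := by
          rw [hM]; field_simp
        linarith
      have e2 : t * ‖R (applyOrZero A (resolvent A (t : ℂ) x))‖ ≤ M * ((M + 1) * ‖(x : X)‖) := by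
        rw [hA.applyOrZero_resolvent_of_mem ht', hR, hA.resolvent_comm h1 ht', ← hR]
        have := mul_le_mul_of_nonneg_left (hA.norm_resolvent_apply_le ht' (R (A x))) ht'.le
        have h2 : t * (resolventBound A / t * ‖R (A x)‖) = M * ‖R (A x)‖ := by
          rw [hM]; field_simp
        have h3 := mul_le_mul_of_nonneg_left (hRAn x) hM0
        linarith
      rw [← div_eq_mul_inv, le_div_iff₀ (by linarith)]
      linarith
    rw [hval]
    refine (norm_add_le _ _).trans ?_
    have e3 := norm_add_le ((σ.c : ℂ) • R x) ((σ.b : ℂ) • R (A x))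
    rw [norm_smul, norm_smul, Complex.norm_real, Complex.norm_real, Real.norm_eq_abs,
      Real.norm_eq_abs] at e3
    have e4 := mul_le_mul_of_nonneg_left (hRx x) (abs_nonneg σ.c)
    have e5 := mul_le_mul_of_nonneg_left (hRAn x) (abs_nonneg σ.b)
    linarith
  refine ⟨(hirschCore σ A hA).graph.topologicalClosure.toLinearPMap, ?_⟩
  rw [Submodule.toLinearPMap_graph_eq]
  rintro ⟨x, y⟩ hxy hx
  have hx : x = 0 := hx
  subst hx
  change y = 0
  have hcl : ∀ p ∈ (hirschCore σ A hA).graph.topologicalClosure, ‖R p.2‖ ≤ C * ‖p.1‖ := by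
    intro p hp
    refine closure_minimal (s := ((hirschCore σ A hA).graph : Set (X × X)))
      (t := {p : X × X | ‖R p.2‖ ≤ C * ‖p.1‖}) ?_ ?_ hp
    · rintro ⟨u, v⟩ huv
      obtain ⟨w, hw1, hw2⟩ := (LinearPMap.mem_graph_iff _).1 huv
      change ‖R v‖ ≤ C * ‖u‖
      simp only at hw1 hw2
      rw [← hw1, ← hw2]
      exact hC w
    · exact isClosed_le (by fun_prop) (by fun_prop)
  have hy := hcl _ hxy
  simp only [norm_zero, mul_zero, norm_le_zero_iff] at hy
  obtain ⟨h, h'⟩ := (hA.spec h1).1 y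
  have h0 : (⟨resolvent A ((1 : ℝ) : ℂ) y, h⟩ : A.domain) = 0 := Subtype.ext hy
  rw [h0, ← hR, hy, smul_zero, LinearPMap.map_zero, sub_zero] at h'
  exact h'.symm

/-- The operator `φ(A)`: the closure of `x ↦ c x + b A x + ∫_{(0, ∞)} A R(t, A) x dμ(t)`,
`x ∈ D(A)`, where `(c, b, μ)` is the representing triple of `φ`. -/
def opFun (φ : ℂ → ℂ) (A : X →ₗ.[ℂ] X) (hA : IsNonpositive A) : X →ₗ.[ℂ] X :=
  (hirschCore (reprTriple φ) A hA).closure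

/-! ### Operator ideals -/

/-- A Banach operator ideal in `X`: a two-sided ideal of the algebra of bounded operators on `X`
with a complete norm `‖·‖_I` such that `‖P S Q‖_I ≤ ‖P‖ ‖S‖_I ‖Q‖` and `‖S‖ ≤ ‖S‖_I`.
(The last condition makes the seminorm `idealNorm` a norm.) -/
structure OperatorIdeal (X : Type*) [NormedAddCommGroup X] [NormedSpace ℂ X] where
  carrier : Submodule ℂ (X →L[ℂ] X)
  mul_mem_mul : ∀ P Q : X →L[ℂ] X, ∀ S ∈ carrier, P * S * Q ∈ carrier
  idealNorm : Seminorm ℂ carrier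
  idealNorm_mul_mul_le : ∀ (P Q : X →L[ℂ] X) (S : carrier),
    idealNorm ⟨P * S * Q, mul_mem_mul P Q S S.2⟩ ≤ ‖P‖ * idealNorm S * ‖Q‖
  norm_le_idealNorm : ∀ S : carrier, ‖(S : X →L[ℂ] X)‖ ≤ idealNorm S
  complete : ∀ u : ℕ → carrier,
    (∀ ε > 0, ∃ N, ∀ m ≥ N, ∀ n ≥ N, idealNorm (u m - u n) < ε) →
      ∃ S : carrier, Tendsto (fun n => idealNorm (u n - S)) atTop (𝓝 0)

end HirschCalculus

end

/-! For `x ∈ D(A)`, `A R(t, A) x - B R(t, B) x = t (R(t, A) - R(t, B)) x`, and the second resolvent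
identity turns this into `t R(t, B) K R(t, A) x`, where `K` extends `A - B`. So the two core
operators differ on `D(A)` by `b K + ∫ t R(t, B) K R(t, A) dμ(t)`. The integrand has ideal norm at
most `M_A M_B ‖K‖ / t`; as the ideal is a Banach space, the integral converges in it once `∫ dμ(t) /
t < ∞`. Since `M_A, M_B ≥ 1` on a nonzero space, the whole element has norm at most `M_A M_B (b + ∫
dμ(t) / t) ‖K‖`. A bounded difference survives passage to the closures
(`isBoundedExtension_closure_sub`), and `b + ∫ dμ(t) / t ≤ φ'(-0)` follows from the mean value
theorem and Fatou's lemma.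

The other half shows that the chosen triple really represents `φ`. Composed with a conformal map of
the disc onto the slit plane, `φ` becomes a typically real function. On smaller discs Rogosinski's
formula writes it as an integral of `ζ / (1 - 2 ζ x + ζ²)` against a positive measure on `[-1, 1]`,
and weak compactness gives the same on the full disc. Under `t = (1 - x) / (1 + x)` the atom at `-1`
becomes `b`, an atom at `1` is excluded by the finite limit `φ(-0)`, and the open interval carries
`μ`. -/

noncomputable section

namespace HirschCalculus

section OperatorDifference

variable {X : Type*} [NormedAddCommGroup X] [NormedSpace ℂ X]

/-! ### An operator ideal as a Banach space -/

namespace OperatorIdeal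

variable (I : OperatorIdeal X)

/-- The elements of the ideal, normed by the ideal norm. -/
def Space : Type _ := I.carrier

instance : AddCommGroup I.Space := inferInstanceAs (AddCommGroup I.carrier)

instance : Module ℂ I.Space := inferInstanceAs (Module ℂ I.carrier)

/-- The submodule itself already inherits the operator norm; the type synonym keeps the two norms
apart. -/
instance : Norm I.Space := ⟨fun S => I.idealNorm S⟩

theorem idealNorm_core : NormedSpace.Core ℂ I.Space where
  norm_nonneg S := apply_nonneg I.idealNorm S
  norm_smul c S := map_smul_eq_mul I.idealNorm c S
  norm_triangle S T := map_add_le_add I.idealNorm S T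
  norm_eq_zero_iff S := by
    refine ⟨fun h => ?_, fun h => ?_⟩
    · have h1 := I.norm_le_idealNorm S
      have h2 : I.idealNorm S = 0 := h
      rw [h2] at h1
      exact Subtype.ext (norm_le_zero_iff.1 h1)
    · rw [h]
      exact map_zero I.idealNorm

instance : NormedAddCommGroup I.Space := NormedAddCommGroup.ofCore I.idealNorm_core

instance : NormedSpace ℂ I.Space := NormedSpace.ofCore I.idealNorm_core

instance : CompleteSpace I.Space := by
  refine Metric.complete_of_cauchySeq_tendsto fun u hu => ?_
  obtain ⟨S, hS⟩ := I.complete u fun ε hε => by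
    obtain ⟨N, hN⟩ := Metric.cauchySeq_iff.1 hu ε hε
    exact ⟨N, fun m hm n hn => (dist_eq_norm (u m) (u n)).symm.trans_lt (hN m hm n hn)⟩
  exact ⟨S, tendsto_iff_norm_sub_tendsto_zero.2 hS⟩

/-- The inclusion of the ideal into the bounded operators. -/
def incl : I.Space →L[ℂ] X →L[ℂ] X :=
  LinearMap.mkContinuous I.carrier.subtype 1 fun S => by
    rw [one_mul]
    exact I.norm_le_idealNorm S

/-- The map `(P, Q) ↦ P K Q` into the ideal. -/
def sandwich (K : I.Space) : (X →L[ℂ] X) →L[ℂ] (X →L[ℂ] X) →L[ℂ] I.Space :=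
  LinearMap.mkContinuous₂
    (LinearMap.mk₂ ℂ
      (fun P Q => (⟨P * I.incl K * Q, I.mul_mem_mul P Q _ (Subtype.property K)⟩ : I.carrier))
      (fun P P' Q => Subtype.ext (by
        change (P + P') * _ * Q = P * _ * Q + P' * _ * Q
        rw [add_mul, add_mul]))
      (fun c P Q => Subtype.ext (by
        change (c • P) * _ * Q = c • (P * _ * Q)
        rw [smul_mul_assoc, smul_mul_assoc]))
      (fun P Q Q' => Subtype.ext (mul_add _ Q Q'))
      (fun c P Q => Subtype.ext (mul_smul_comm c _ Q)))
    ‖K‖ fun P Q => by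
      have h := I.idealNorm_mul_mul_le P Q K
      calc _ ≤ ‖P‖ * ‖K‖ * ‖Q‖ := h
        _ = _ := by ring

theorem norm_sandwich_le (K : I.Space) (P Q : X →L[ℂ] X) :
    ‖I.sandwich K P Q‖ ≤ ‖P‖ * ‖K‖ * ‖Q‖ :=
  I.idealNorm_mul_mul_le P Q K

end OperatorIdeal

/-! ### Resolvents of nonpositive operators -/

namespace IsNonpositive

variable {A B : X →ₗ.[ℂ] X}

/-- The resolvent identity gives `‖R(s, A) - R(t, A)‖ ≤ |t - s| M² / (s t)`. Continuity in operator
norm, not just strong continuity, makes the ideal-valued integrand below measurable. -/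
theorem continuousOn_resolvent_norm (hA : IsNonpositive A) :
    ContinuousOn (fun t : ℝ => resolvent A (t : ℂ)) (Ioi 0) := by
  intro t ht
  have ht' : (0 : ℝ) < t := ht
  rw [ContinuousWithinAt, tendsto_iff_norm_sub_tendsto_zero]
  have hM := resolventBound_nonneg A
  have hlim : Tendsto (fun s : ℝ => |t - s| * (resolventBound A / s * (resolventBound A / t)))
      (𝓝[Ioi 0] t) (𝓝 (|t - t| * (resolventBound A / t * (resolventBound A / t)))) := by
    refine Tendsto.mono_left ?_ nhdsWithin_le_nhds
    refine ContinuousAt.tendsto (f := fun s : ℝ =>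
      |t - s| * (resolventBound A / s * (resolventBound A / t))) ?_
    have : t ≠ 0 := ht'.ne'
    fun_prop (disch := assumption)
  rw [sub_self, abs_zero, zero_mul] at hlim
  refine squeeze_zero' (Eventually.of_forall fun _ => norm_nonneg _) ?_ hlim
  filter_upwards [self_mem_nhdsWithin] with s hs
  have hs' : (0 : ℝ) < s := hs
  refine ContinuousLinearMap.opNorm_le_bound _ (by positivity) fun x => ?_
  rw [sub_apply, hA.resolvent_sub hs' ht', norm_smul, mul_assoc, mul_assoc]
  refine mul_le_mul (le_of_eq ?_) ((hA.norm_resolvent_apply_le hs' _).trans ?_) (norm_nonneg _)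
    (abs_nonneg _)
  · rw [← Complex.ofReal_sub, Complex.norm_real, Real.norm_eq_abs]
  · exact mul_le_mul_of_nonneg_left (hA.norm_resolvent_apply_le ht' x) (by positivity)

/-- `R(t, A) - R(t, B) = R(t, B) K R(t, A)` if `K` extends `A - B`. -/
theorem resolvent_sub_resolvent (hA : IsNonpositive A) (hB : IsNonpositive B)
    (hAB : A.domain ≤ B.domain) {K : X →L[ℂ] X} (hK : IsBoundedExtension (A - B) K)
    {t : ℝ} (ht : 0 < t) :
    resolvent A (t : ℂ) - resolvent B (t : ℂ) =
      resolvent B (t : ℂ) * K * resolvent A (t : ℂ) := by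
  ext x
  obtain ⟨h, h'⟩ := (hA.spec ht).1 x
  -- `R(t, A) x` lies in `D(A) ⊆ D(B)`, so `R(t, B) (t - B)` fixes it.
  have h1 := (hB.spec ht).2 ⟨_, hAB h⟩
  have h2 := hK.2 ⟨resolvent A (t : ℂ) x, h, hAB h⟩
  rw [LinearPMap.sub_apply] at h2
  have h2' : A ⟨resolvent A (t : ℂ) x, h⟩ - B ⟨resolvent A (t : ℂ) x, hAB h⟩ =
    K (resolvent A (t : ℂ) x) := h2
  change resolvent A (t : ℂ) x - resolvent B (t : ℂ) x =
    resolvent B (t : ℂ) (K (resolvent A (t : ℂ) x))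
  have h1' : resolvent B (t : ℂ) ((t : ℂ) • resolvent A (t : ℂ) x -
    B ⟨resolvent A (t : ℂ) x, hAB h⟩) = resolvent A (t : ℂ) x := h1
  rw [← h2', sub_eq_iff_eq_add, ← map_add]
  refine h1'.symm.trans (congrArg _ ?_)
  rw [← sub_eq_iff_eq_add'.2 (sub_eq_iff_eq_add.1 h')]
  abel

/-- `M_A ≥ 1` on a nontrivial space, since `t R(t, A) x → x` as `t → ∞` for `x ∈ D(A)`. -/
theorem one_le_resolventBound [Nontrivial X] (hA : IsNonpositive A) :
    1 ≤ resolventBound A := by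
  set M := resolventBound A with hM
  have hM0 : 0 ≤ M := resolventBound_nonneg A
  -- From `x = t R(t, A) x - R(t, A) A x` one gets `‖x‖ ≤ M ‖x‖ + (M / t) ‖A x‖`; then `t → ∞`.
  have hle : ∀ x : A.domain, ‖(x : X)‖ ≤ M * ‖(x : X)‖ := by
    intro x
    have hlim : Tendsto (fun t : ℝ => M * ‖(x : X)‖ + M / t * ‖A x‖) atTop
        (𝓝 (M * ‖(x : X)‖ + 0 * ‖A x‖)) :=
      tendsto_const_nhds.add ((tendsto_const_nhds.div_atTop tendsto_id).mul_const _)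
    rw [zero_mul, add_zero] at hlim
    refine ge_of_tendsto hlim ?_
    filter_upwards [eventually_gt_atTop 0] with t ht
    have h := (hA.spec ht).2 x
    calc ‖(x : X)‖ = ‖(t : ℂ) • resolvent A (t : ℂ) (x : X) - resolvent A (t : ℂ) (A x)‖ := by
          rw [← map_smul, ← map_sub, h]
      _ ≤ ‖(t : ℂ) • resolvent A (t : ℂ) (x : X)‖ + ‖resolvent A (t : ℂ) (A x)‖ :=
          norm_sub_le _ _
      _ ≤ M * ‖(x : X)‖ + M / t * ‖A x‖ := by
          refine add_le_add ?_ (hA.norm_resolvent_apply_le ht _)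
          rw [norm_smul, Complex.norm_real, Real.norm_eq_abs, abs_of_pos ht]
          calc t * ‖resolvent A (t : ℂ) (x : X)‖ ≤ t * (M / t * ‖(x : X)‖) :=
                mul_le_mul_of_nonneg_left (hA.norm_resolvent_apply_le ht _) ht.le
            _ = M * ‖(x : X)‖ := by field_simp
  obtain ⟨x, hx⟩ : ∃ x : A.domain, (x : X) ≠ 0 := by
    by_contra! h
    obtain ⟨y, hy⟩ := exists_ne (0 : X)
    obtain ⟨z, hz, hz'⟩ := hA.dense_domain.exists_mem_open isOpen_compl_singleton ⟨y, hy⟩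
    exact hz' (h ⟨z, hz⟩)
  have := hle x
  have hpos : 0 < ‖(x : X)‖ := norm_pos_iff.2 hx
  exact le_of_mul_le_mul_right (by rwa [one_mul]) hpos

/-- The function `t ↦ t R(t, B) K R(t, A)` is integrable with values in the ideal if
`∫ dμ(t) / t < ∞`, and its integral has norm at most `M_A M_B ‖K‖ ∫ dμ(t) / t`. -/
theorem integrableOn_sandwich (hA : IsNonpositive A) (hB : IsNonpositive B) (I : OperatorIdeal X)
    (K : I.Space) {μ : Measure ℝ} (hμ : IntegrableOn (fun t : ℝ => t⁻¹) (Ioi 0) μ) :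
    IntegrableOn (fun t : ℝ =>
      (t : ℂ) • I.sandwich K (resolvent B (t : ℂ)) (resolvent A (t : ℂ))) (Ioi 0) μ ∧
    ‖∫ t in Ioi (0 : ℝ),
      (t : ℂ) • I.sandwich K (resolvent B (t : ℂ)) (resolvent A (t : ℂ)) ∂μ‖ ≤
      resolventBound A * resolventBound B * ‖K‖ * ∫ t in Ioi (0 : ℝ), t⁻¹ ∂μ := by
  have hcont : ContinuousOn (fun t : ℝ =>
      (t : ℂ) • I.sandwich K (resolvent B (t : ℂ)) (resolvent A (t : ℂ))) (Ioi 0) :=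
    Complex.continuous_ofReal.continuousOn.smul
      (((I.sandwich K).continuous.comp_continuousOn hB.continuousOn_resolvent_norm).clm_apply
        hA.continuousOn_resolvent_norm)
  have hbound : ∀ᵐ t : ℝ ∂μ.restrict (Ioi 0),
      ‖(t : ℂ) • I.sandwich K (resolvent B (t : ℂ)) (resolvent A (t : ℂ))‖ ≤
        resolventBound A * resolventBound B * ‖K‖ * t⁻¹ := by
    rw [ae_restrict_iff' measurableSet_Ioi]
    refine Eventually.of_forall fun t ht => ?_
    have ht' : (0 : ℝ) < t := ht
    have hMB := resolventBound_nonneg B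
    rw [norm_smul, Complex.norm_real, Real.norm_eq_abs, abs_of_pos ht']
    calc t * ‖I.sandwich K (resolvent B (t : ℂ)) (resolvent A (t : ℂ))‖
        ≤ t * (resolventBound B / t * ‖K‖ * (resolventBound A / t)) := by
          refine mul_le_mul_of_nonneg_left ((I.norm_sandwich_le K _ _).trans ?_) ht'.le
          gcongr
          · exact hB.norm_resolvent_le ht'
          · exact hA.norm_resolvent_le ht'
      _ = resolventBound A * resolventBound B * ‖K‖ * t⁻¹ := by field_simp
  refine ⟨Integrable.mono' (hμ.const_mul _) (hcont.aestronglyMeasurable measurableSet_Ioi) hbound,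
    ?_⟩
  rw [← integral_const_mul]
  exact norm_integral_le_of_norm_le (hμ.const_mul _) hbound

end IsNonpositive

/-! ### The difference of the functional calculi -/

variable {A B : X →ₗ.[ℂ] X}

/-- The element `b K + ∫ t R(t, B) K R(t, A) dμ(t)` of the ideal. -/
def differenceElement (σ : ReprTriple) (A B : X →ₗ.[ℂ] X) (I : OperatorIdeal X) (K : I.Space) :
    I.Space :=
  (σ.b : ℂ) • K + ∫ t in Ioi (0 : ℝ),
    (t : ℂ) • I.sandwich K (resolvent B (t : ℂ)) (resolvent A (t : ℂ)) ∂σ.μ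

/-- The `c` terms cancel, and so do the identities in `A R(t, A) = t R(t, A) - I` and its analogue
for `B`; the second resolvent identity handles what remains. -/
theorem hirschCore_sub [CompleteSpace X] (σ : ReprTriple) (hσ : IntegrableOn (fun t : ℝ => t⁻¹) (Ioi 0) σ.μ)
    (hA : IsNonpositive A) (hB : IsNonpositive B) (hAB : A.domain ≤ B.domain)
    (I : OperatorIdeal X) (K : I.Space) (hK : IsBoundedExtension (A - B) (I.incl K))
    (x : X) (hx : x ∈ A.domain) :
    hirschCore σ A hA ⟨x, hx⟩ - hirschCore σ B hB ⟨x, hAB hx⟩ =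
      I.incl (differenceElement σ A B I K) x := by
  have hint := (hA.integrableOn_sandwich hB I K hσ).1
  have h1 : I.incl (differenceElement σ A B I K) x = (σ.b : ℂ) • I.incl K x +
      ∫ t in Ioi (0 : ℝ), (t : ℂ) •
        (resolvent B (t : ℂ) * I.incl K * resolvent A (t : ℂ)) x ∂σ.μ := by
    -- Evaluation at `x` is bounded on the ideal, so the integral in the ideal norm can be computed
    -- pointwise.
    have := ((ContinuousLinearMap.apply ℂ X x).comp I.incl).integral_comp_comm hint
    rw [differenceElement, map_add, map_smul]
    change (σ.b : ℂ) • I.incl K x + ((ContinuousLinearMap.apply ℂ X x).comp I.incl) _ = _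
    rw [← this]
    simp only [map_smul]
    rfl
  have h2 : I.incl K x = A ⟨x, hx⟩ - B ⟨x, hAB hx⟩ := (hK.2 ⟨x, hx, hAB hx⟩).symm
  have h3 : ∫ t in Ioi (0 : ℝ), (t : ℂ) •
        (resolvent B (t : ℂ) * I.incl K * resolvent A (t : ℂ)) x ∂σ.μ =
      ∫ t in Ioi (0 : ℝ), (applyOrZero A (resolvent A (t : ℂ) x) -
        applyOrZero B (resolvent B (t : ℂ) x)) ∂σ.μ := by
    refine setIntegral_congr_fun measurableSet_Ioi fun t ht => ?_
    rw [← hA.resolvent_sub_resolvent hB hAB hK ht, hA.applyOrZero_resolvent ht,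
      hB.applyOrZero_resolvent ht, sub_apply, smul_sub]
    abel
  rw [h1, h2, h3, integral_sub (hA.integrableOn_applyOrZero σ ⟨x, hx⟩)
    (hB.integrableOn_applyOrZero σ ⟨x, hAB hx⟩)]
  change ((σ.c : ℂ) • x + (σ.b : ℂ) • A ⟨x, hx⟩ + _) -
    ((σ.c : ℂ) • x + (σ.b : ℂ) • B ⟨x, hAB hx⟩ + _) = _
  rw [smul_sub]
  abel

/-- If two closable operators differ by a bounded operator on the domain of the first, contained
in that of the second, then so do their closures. -/
theorem isBoundedExtension_closure_sub {F G : X →ₗ.[ℂ] X} (hF : F.IsClosable)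
    (hG : G.IsClosable) (hd : Dense (F.domain : Set X)) (hFG : F.domain ≤ G.domain)
    {S : X →L[ℂ] X} (hS : ∀ x (hx : x ∈ F.domain), F ⟨x, hx⟩ - G ⟨x, hFG hx⟩ = S x) :
    IsBoundedExtension (F.closure - G.closure) S := by
  refine ⟨hd.mono fun x hx => ⟨F.le_closure.1 hx, G.le_closure.1 (hFG hx)⟩, fun x => ?_⟩
  -- The shear `(x, y) ↦ (x, y - S x)` is continuous and maps the graph of `F` into that of `G`,
  -- hence closure into closure.
  have hcl : ∀ p ∈ F.closure.graph, (p.1, p.2 - S p.1) ∈ G.closure.graph := by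
    intro p hp
    rw [← hF.graph_closure_eq_closure_graph] at hp
    refine closure_minimal (s := (F.graph : Set (X × X)))
      (t := {p : X × X | (p.1, p.2 - S p.1) ∈ G.closure.graph}) ?_ ?_ hp
    · rintro ⟨u, v⟩ huv
      obtain ⟨⟨w, hw⟩, hw1, hw2⟩ := (LinearPMap.mem_graph_iff _).1 huv
      simp only at hw1 hw2
      subst hw1
      change (w, v - S w) ∈ G.closure.graph
      refine LinearPMap.le_graph_of_le G.le_closure ?_
      rw [← hw2, ← hS w hw, sub_sub_cancel]
      exact G.mem_graph ⟨w, hFG hw⟩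
    · exact hG.closure_isClosed.preimage
        (f := fun p : X × X => (p.1, p.2 - S p.1)) (by fun_prop)
  have h1 := hcl _ (F.closure.mem_graph ⟨x, x.2.1⟩)
  obtain ⟨y, hy1, hy2⟩ := (LinearPMap.mem_graph_iff _).1 h1
  simp only at hy1 hy2
  have hy : y = ⟨x, x.2.2⟩ := Subtype.ext hy1
  rw [hy] at hy2
  rw [LinearPMap.sub_apply]
  change F.closure ⟨x, x.2.1⟩ - G.closure ⟨x, x.2.2⟩ = _
  rw [hy2, sub_sub_cancel]

/-- The term `b K` contains no resolvents; its bound `b ‖K‖` is absorbed using `M_A M_B ≥ 1`. -/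
theorem norm_differenceElement_le (σ : ReprTriple)
    (hσ : IntegrableOn (fun t : ℝ => t⁻¹) (Ioi 0) σ.μ)
    (hA : IsNonpositive A) (hB : IsNonpositive B) (I : OperatorIdeal X) (K : I.Space) :
    ‖differenceElement σ A B I K‖ ≤ resolventBound A * resolventBound B *
      (σ.b + ∫ t in Ioi (0 : ℝ), t⁻¹ ∂σ.μ) * ‖K‖ := by
  have hb : σ.b * ‖K‖ ≤ resolventBound A * resolventBound B * σ.b * ‖K‖ := by
    -- On the zero space `M_A M_B ≥ 1` fails, but there `K = 0`.
    rcases subsingleton_or_nontrivial X with hX | hX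
    · have hK : K = 0 := Subtype.ext (ContinuousLinearMap.ext fun x => Subsingleton.elim _ _)
      simp [hK]
    · have h1 : 1 ≤ resolventBound A * resolventBound B :=
        one_le_mul_of_one_le_of_one_le hA.one_le_resolventBound hB.one_le_resolventBound
      have h2 : 0 ≤ σ.b * ‖K‖ := mul_nonneg σ.b_nonneg (norm_nonneg _)
      nlinarith
  have h := (hA.integrableOn_sandwich hB I K hσ).2
  refine (norm_add_le _ _).trans ?_
  rw [norm_smul, Complex.norm_real, Real.norm_eq_abs, abs_of_nonneg σ.b_nonneg]
  nlinarith

end OperatorDifference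

/-! ### Preliminaries on the slit plane and Fatou's lemma -/

theorem mem_slit_iff {z : ℂ} : z ∈ (Complex.ofReal '' Ici 0)ᶜ ↔ z.re < 0 ∨ z.im ≠ 0 := by
  rw [mem_compl_iff, ← not_iff_not, not_not, not_or, not_not, not_lt]
  refine ⟨?_, fun h => ⟨z.re, h.1, Complex.ext rfl (by simp [h.2])⟩⟩
  rintro ⟨x, hx, rfl⟩
  exact ⟨hx, Complex.ofReal_im x⟩

theorem isOpen_slit : IsOpen (Complex.ofReal '' Ici 0)ᶜ := by
  have h : (Complex.ofReal '' Ici 0)ᶜ = {z : ℂ | z.re < 0} ∪ {z : ℂ | z.im ≠ 0} :=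
    Set.ext fun z => mem_slit_iff
  rw [h]
  exact (isOpen_lt Complex.continuous_re continuous_const).union
    (isOpen_ne_fun Complex.continuous_im continuous_const)

theorem ofReal_mem_slit {x : ℝ} (hx : x < 0) : (x : ℂ) ∈ (Complex.ofReal '' Ici 0)ᶜ :=
  mem_slit_iff.2 (Or.inl (by simpa using hx))

/-- Fatou's lemma for nonnegative real functions with bounded integrals. -/
theorem integrable_and_integral_le_of_tendsto {α : Type*} [MeasurableSpace α] {μ : Measure α}
    {F : ℕ → α → ℝ} {f : α → ℝ} (hF : ∀ n, Integrable (F n) μ) (h0 : ∀ n, 0 ≤ᵐ[μ] F n)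
    (hf : ∀ᵐ a ∂μ, Tendsto (fun n => F n a) atTop (𝓝 (f a))) {u : ℕ → ℝ}
    (hu : ∀ n, ∫ a, F n a ∂μ ≤ u n) {c : ℝ} (hc : Tendsto u atTop (𝓝 c)) :
    Integrable f μ ∧ ∫ a, f a ∂μ ≤ c := by
  have hmeas : AEStronglyMeasurable f μ :=
    aestronglyMeasurable_of_tendsto_ae atTop (fun n => (hF n).aestronglyMeasurable) hf
  have hnn : 0 ≤ᵐ[μ] f := by
    filter_upwards [hf, ae_all_iff.2 h0] with a ha h0a
    exact ge_of_tendsto' ha h0a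
  have hc0 : 0 ≤ c := ge_of_tendsto' hc fun n => (integral_nonneg_of_ae (h0 n)).trans (hu n)
  have hle : ∫⁻ a, ENNReal.ofReal (f a) ∂μ ≤ ENNReal.ofReal c := by
    calc ∫⁻ a, ENNReal.ofReal (f a) ∂μ
        = ∫⁻ a, liminf (fun n => ENNReal.ofReal (F n a)) atTop ∂μ := by
          refine lintegral_congr_ae ?_
          filter_upwards [hf] with a ha
          exact ((ENNReal.continuous_ofReal.tendsto _).comp ha).liminf_eq.symm
      _ ≤ liminf (fun n => ∫⁻ a, ENNReal.ofReal (F n a) ∂μ) atTop :=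
          lintegral_liminf_le' fun n => (hF n).aemeasurable.ennreal_ofReal
      _ ≤ liminf (fun n => ENNReal.ofReal (u n)) atTop := by
          refine liminf_le_liminf (Eventually.of_forall fun n => ?_)
          rw [← ofReal_integral_eq_lintegral_ofReal (hF n) (h0 n)]
          exact ENNReal.ofReal_le_ofReal (hu n)
      _ = ENNReal.ofReal c := ((ENNReal.continuous_ofReal.tendsto _).comp hc).liminf_eq
  refine ⟨⟨hmeas, ?_⟩, ?_⟩
  · rw [hasFiniteIntegral_iff_ofReal hnn]
    exact hle.trans_lt ENNReal.ofReal_lt_top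
  · rw [integral_eq_lintegral_of_nonneg_ae hnn hmeas]
    exact ENNReal.toReal_le_of_le_ofReal hc0 hle

/-! ### The derivative at `-0` in terms of the representation -/

namespace ReprTriple

variable (σ : ReprTriple)

theorem integrableOn_div_sub {x : ℝ} (hx : x < 0) :
    IntegrableOn (fun t : ℝ => x / (t - x)) (Ioi 0) σ.μ := by
  refine Integrable.mono' (σ.integrableOn.const_mul (1 - x)) ?_ ?_
  · exact Measurable.aestronglyMeasurable (by fun_prop)
  · rw [ae_restrict_iff' measurableSet_Ioi]
    refine Eventually.of_forall fun t ht => ?_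
    have ht' : (0 : ℝ) < t := ht
    rw [Real.norm_eq_abs, abs_div, abs_of_neg hx, abs_of_pos (by linarith : 0 < t - x),
      ← div_eq_mul_inv, div_le_div_iff₀ (by linarith) (by linarith)]
    nlinarith [mul_pos_of_neg_of_neg hx hx]

theorem re_eq_of_represents {φ : ℂ → ℂ} (h : σ.Represents φ) {x : ℝ} (hx : x < 0) :
    (φ x).re = σ.c + σ.b * x + ∫ t in Ioi (0 : ℝ), x / (t - x) ∂σ.μ := by
  have h1 : ∫ t in Ioi (0 : ℝ), (x : ℂ) / ((t : ℂ) - x) ∂σ.μ =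
      ((∫ t in Ioi (0 : ℝ), x / (t - x) ∂σ.μ : ℝ) : ℂ) := by
    rw [← integral_complex_ofReal]
    simp
  rw [h x (ofReal_mem_slit hx), h1]
  norm_cast

/-- If `φ'(-0) = d` is finite, then `b + ∫ dμ(t) / t ≤ d`. -/
theorem integrableOn_inv_of_hasDerivLimit {φ : ℂ → ℂ} (h : σ.Represents φ)
    (hφ : DifferentiableOn ℂ φ (Complex.ofReal '' Ici 0)ᶜ) {d : ℝ} (hd : HasDerivLimit φ d) :
    IntegrableOn (fun t : ℝ => t⁻¹) (Ioi 0) σ.μ ∧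
      σ.b + ∫ t in Ioi (0 : ℝ), t⁻¹ ∂σ.μ ≤ d := by
  set f : ℝ → ℝ := fun x => (φ x).re with hf
  have hderiv : ∀ x : ℝ, x < 0 → HasDerivAt f (deriv φ x).re x := fun x hx =>
    ((hφ.differentiableAt (isOpen_slit.mem_nhds (ofReal_mem_slit hx))).hasDerivAt).real_of_complex
  -- The slope of `φ` over `[2 x n, x n]` is `φ'` at an intermediate point `ξ n → 0-`, and by the
  -- representation it equals `b + ∫ t / ((t - x n) (t - 2 x n)) dμ(t)`. This avoids differentiating
  -- under the integral.
  set x : ℕ → ℝ := fun n => -(1 / ((n : ℝ) + 1)) with hx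
  have hx0 : ∀ n, x n < 0 := fun n => neg_lt_zero.2 Nat.one_div_pos_of_nat
  have hxlim : Tendsto x atTop (𝓝 0) := by
    have := (tendsto_one_div_add_atTop_nhds_zero_nat (𝕜 := ℝ)).neg
    rwa [neg_zero] at this
  have hmvt : ∀ n, ∃ ξ ∈ Ioo (2 * x n) (x n),
      (deriv φ (ξ : ℂ)).re = (f (x n) - f (2 * x n)) / (x n - 2 * x n) := fun n => by
    have hlt : 2 * x n < x n := by linarith [hx0 n]
    refine exists_hasDerivAt_eq_slope f _ hlt (fun y hy => ?_) fun y hy => ?_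
    · exact (hderiv y (hy.2.trans_lt (hx0 n))).continuousAt.continuousWithinAt
    · exact hderiv y (hy.2.trans (hx0 n))
  choose ξ hξ hξ' using hmvt
  have hξlim : Tendsto ξ atTop (𝓝[<] 0) := by
    refine tendsto_nhdsWithin_iff.2 ⟨?_, Eventually.of_forall fun n => (hξ n).2.trans (hx0 n)⟩
    have h2 : Tendsto (fun n => 2 * x n) atTop (𝓝 0) := by simpa using hxlim.const_mul 2
    exact tendsto_of_tendsto_of_tendsto_of_le_of_le h2 hxlim (fun n => (hξ n).1.le)
      fun n => (hξ n).2.le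
  have hlim : Tendsto (fun n => (deriv φ (ξ n : ℂ)).re - σ.b) atTop (𝓝 (d - σ.b)) := by
    have := (Complex.continuous_re.tendsto _).comp (hd.comp hξlim)
    rw [Complex.ofReal_re] at this
    exact this.sub_const _
  have hint : ∀ n, IntegrableOn (fun t : ℝ => t / ((t - x n) * (t - 2 * x n))) (Ioi 0) σ.μ ∧
      ∫ t in Ioi (0 : ℝ), t / ((t - x n) * (t - 2 * x n)) ∂σ.μ =
        (deriv φ (ξ n : ℂ)).re - σ.b := fun n => by
    have hn := hx0 n
    have h1 := σ.integrableOn_div_sub hn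
    have h2 := σ.integrableOn_div_sub (by linarith : 2 * x n < 0)
    have heq : EqOn (fun t : ℝ => (x n / (t - x n) - 2 * x n / (t - 2 * x n)) / (x n - 2 * x n))
        (fun t : ℝ => t / ((t - x n) * (t - 2 * x n))) (Ioi 0) := fun t ht => by
      have ht' : (0 : ℝ) < t := ht
      have e1 : t - x n ≠ 0 := by linarith
      have e2 : t - 2 * x n ≠ 0 := by linarith
      have e3 : x n - 2 * x n ≠ 0 := by linarith
      dsimp only
      rw [div_sub_div _ _ e1 e2, div_div, div_eq_div_iff (by positivity) (by positivity)]
      ring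
    have h3 : IntegrableOn
        (fun t : ℝ => (x n / (t - x n) - 2 * x n / (t - 2 * x n)) / (x n - 2 * x n)) (Ioi 0) σ.μ :=
      (h1.sub h2).div_const _
    refine ⟨h3.congr_fun heq measurableSet_Ioi, ?_⟩
    rw [← setIntegral_congr_fun measurableSet_Ioi heq, integral_div, integral_sub h1 h2, hξ', hf]
    dsimp only
    have h4 := σ.re_eq_of_represents h hn
    have h5 := σ.re_eq_of_represents h (by linarith : 2 * x n < 0)
    rw [h4, h5]
    have e3 : x n - 2 * x n ≠ 0 := by linarith
    rw [eq_sub_iff_add_eq, ← eq_sub_iff_add_eq', ← sub_div, eq_div_iff e3]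
    ring
  have hfatou := integrable_and_integral_le_of_tendsto (μ := σ.μ.restrict (Ioi 0))
    (F := fun n t => t / ((t - x n) * (t - 2 * x n))) (f := fun t : ℝ => t⁻¹)
    (fun n => (hint n).1) (fun n => ?_) ?_ (fun n => (hint n).2.le) hlim
  · exact ⟨hfatou.1, by linarith [hfatou.2]⟩
  · refine (ae_restrict_iff' measurableSet_Ioi).2 (Eventually.of_forall fun t ht => ?_)
    have ht' : (0 : ℝ) < t := ht
    have hn := hx0 n
    exact div_nonneg ht'.le (mul_nonneg (by linarith) (by linarith))
  · refine (ae_restrict_iff' measurableSet_Ioi).2 (Eventually.of_forall fun t ht => ?_)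
    have ht' : (0 : ℝ) < t := ht
    have h1 : Tendsto (fun n => t / ((t - x n) * (t - 2 * x n))) atTop
        (𝓝 (t / ((t - 0) * (t - 2 * 0)))) :=
      tendsto_const_nhds.div ((tendsto_const_nhds.sub hxlim).mul
        (tendsto_const_nhds.sub (hxlim.const_mul 2))) (by simp [ht'.ne'])
    rwa [mul_zero, sub_zero, ← div_div, div_self ht'.ne', one_div] at h1

end ReprTriple

/-! ### Typically real functions on the unit disc -/

open Real ComplexConjugate Metric in
/-- **Rogosinski's formula** for a function on the closed unit disc. -/
theorem sub_eq_circleAverage_of_conj {h : ℂ → ℂ} (hh : DiffContOnCl ℂ h (ball 0 1))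
    (hconj : ∀ s ∈ sphere (0 : ℂ) 1, h (conj s) = conj (h s)) {ζ : ℂ} (hζ : ζ ∈ ball (0 : ℂ) 1) :
    h ζ - h 0 = circleAverage
      (fun s => ((2 * (s.im * (h s).im) : ℝ) : ℂ) * (ζ / (1 - 2 * ζ * s.re + ζ ^ 2))) 0 1 := by
  have hh' : DiffContOnCl ℂ h (ball 0 |1|) := by rwa [abs_one]
  have hζ' : ζ ∈ ball (0 : ℂ) |1| := by rwa [abs_one]
  have hζ1 : ‖ζ‖ < 1 := by simpa using hζ
  have hcl : closure (ball (0 : ℂ) 1) = closedBall 0 1 := closure_ball _ one_ne_zero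
  have hcont : ContinuousOn h (sphere 0 1) := by
    have := hh.continuousOn
    rw [hcl] at this
    exact this.mono sphere_subset_closedBall
  have hs0 : ∀ s ∈ sphere (0 : ℂ) 1, s ≠ 0 := fun s hs h0 => by simp [h0] at hs
  have hne : ∀ s ∈ sphere (0 : ℂ) 1, s - ζ ≠ 0 := fun s hs h0 => by
    rw [sub_eq_zero] at h0
    rw [← h0] at hζ1
    have : ‖s‖ = 1 := by simpa using hs
    linarith
  have hinv : ∀ s ∈ sphere (0 : ℂ) 1, s⁻¹ ∈ sphere (0 : ℂ) 1 := fun s hs => by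
    simpa using hs
  have hinvconj : ∀ s ∈ sphere (0 : ℂ) 1, s⁻¹ = conj s := fun s hs =>
    Complex.inv_eq_conj (by simpa using hs)
  have hne' : ∀ z ∈ closedBall (0 : ℂ) 1, 1 - ζ * z ≠ 0 := fun z hz h0 => by
    have h1 : ‖z‖ ≤ 1 := by simpa using hz
    have h2 : ‖ζ * z‖ < 1 := by
      rw [norm_mul]
      calc ‖ζ‖ * ‖z‖ ≤ ‖ζ‖ * 1 := mul_le_mul_of_nonneg_left h1 (norm_nonneg _)
        _ < 1 := by rwa [mul_one]
    rw [← sub_eq_zero.1 h0] at h2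
    simp at h2
  -- On the circle `s⁻¹ = conj s` and `v s = ζ / (s⁻¹ - ζ) * h s`. The integrand is half of `u - v`
  -- symmetrised under `s ↦ s⁻¹`, which preserves circle averages, so its average is that of `u -
  -- v`.
  set u : ℂ → ℂ := fun s => ζ / (s - ζ) * h s with hu
  set v : ℂ → ℂ := fun s => ζ * s / (1 - ζ * s) * h s with hv
  have hucont : ContinuousOn u (sphere 0 1) :=
    (continuousOn_const.div (continuousOn_id.sub continuousOn_const) hne).mul hcont
  have hvd : DiffContOnCl ℂ v (ball 0 |1|) := by
    have h1 : DiffContOnCl ℂ (fun s => ζ * s / (1 - ζ * s)) (ball 0 |1|) := by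
      rw [abs_one]
      refine DifferentiableOn.diffContOnCl ?_
      rw [hcl]
      intro z hz
      have := hne' z hz
      exact DifferentiableAt.differentiableWithinAt (by fun_prop (disch := assumption))
    exact h1.smul hh'
  have hvcont : ContinuousOn v (sphere 0 1) := by
    have := hvd.continuousOn
    rw [abs_one, hcl] at this
    exact this.mono sphere_subset_closedBall
  have hinvcont : ContinuousOn (fun s : ℂ => s⁻¹) (sphere 0 1) := continuousOn_inv₀.mono hs0
  have hu' : ContinuousOn (fun s => u s⁻¹) (sphere 0 1) := hucont.comp hinvcont hinv
  have hv' : ContinuousOn (fun s => v s⁻¹) (sphere 0 1) := hvcont.comp hinvcont hinv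
  have iu := hucont.circleIntegrable zero_le_one
  have iv := hvcont.circleIntegrable zero_le_one
  have iu' := hu'.circleIntegrable zero_le_one
  have iv' := hv'.circleIntegrable zero_le_one
  have hpt : EqOn (fun s => ((2 * (s.im * (h s).im) : ℝ) : ℂ) *
      (ζ / (1 - 2 * ζ * s.re + ζ ^ 2)))
      (fun s => (1 / 2 : ℂ) • ((u s + u s⁻¹) - (v s + v s⁻¹))) (sphere 0 |1|) := by
    rw [abs_one]
    intro s hs
    have e0 := hs0 s hs
    have e1 := hne s hs
    have e2 := hne _ (hinv s hs)
    have e3 := hne' s (sphere_subset_closedBall hs)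
    have e4 := hne' _ (sphere_subset_closedBall (hinv s hs))
    have him : (s.im : ℂ) = (s - s⁻¹) / (2 * Complex.I) := by
      rw [hinvconj s hs, Complex.im_eq_sub_conj]
    have hhim : ((h s).im : ℂ) = (h s - h s⁻¹) / (2 * Complex.I) := by
      rw [hinvconj s hs, hconj s hs, Complex.im_eq_sub_conj]
    have hre : (s.re : ℂ) = (s + s⁻¹) / 2 := by
      rw [hinvconj s hs, Complex.re_eq_add_conj]
    have hden : 1 - 2 * ζ * ((s + s⁻¹) / 2) + ζ ^ 2 = (s - ζ) * (s⁻¹ - ζ) := by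
      field_simp
      ring
    simp only [hu, hv, smul_eq_mul]
    push_cast
    rw [him, hhim, hre, hden]
    have e5 : ζ * s / (1 - ζ * s) = ζ / (s⁻¹ - ζ) := by
      rw [div_eq_div_iff e3 e2]
      field_simp
    have e6 : ζ * s⁻¹ / (1 - ζ * s⁻¹) = ζ / (s - ζ) := by
      rw [div_eq_div_iff e4 e1]
      field_simp
    rw [e5, e6]
    have hI : (2 * Complex.I) * (2 * Complex.I) = -4 := by
      linear_combination 4 * Complex.I_mul_I
    rw [div_mul_div_comm, hI]
    generalize hq : s⁻¹ = q at *
    field_simp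
    ring
  rw [circleAverage_congr_sphere hpt, circleAverage_fun_smul,
    circleAverage_fun_sub (f₁ := fun s => u s + u s⁻¹) (f₂ := fun s => v s + v s⁻¹)
      (iu.add iu') (iv.add iv'),
    circleAverage_fun_add iu iu', circleAverage_fun_add iv iv',
    circleAverage_zero_one_congr_inv, circleAverage_zero_one_congr_inv]
  have hav : circleAverage v 0 1 = 0 := by
    rw [hvd.circleAverage]
    simp [hv]
  -- `ζ / (s - ζ) = s / (s - ζ) - 1`: Cauchy's formula minus the mean value property.
  have hau : circleAverage u 0 1 = h ζ - h 0 := by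
    rw [← hh'.circleAverage_smul_div hζ', ← hh'.circleAverage]
    have hdcont : ContinuousOn (fun z => ((z - 0) / (z - ζ)) • h z) (sphere 0 1) :=
      ((continuousOn_id.sub continuousOn_const).div
        (continuousOn_id.sub continuousOn_const) hne).smul hcont
    rw [← circleAverage_fun_sub (hdcont.circleIntegrable zero_le_one)
      (hcont.circleIntegrable zero_le_one)]
    refine circleAverage_congr_sphere fun s hs => ?_
    rw [abs_one] at hs
    have e1 := hne s hs
    simp only [hu, smul_eq_mul]
    field_simp
    ring
  rw [hav, hau]
  simp
  ring

open Real ComplexConjugate Metric in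
/-- A typically real function on the closed unit disc is represented by a measure on `[-1, 1]`. -/
theorem exists_measure_of_closedBall {h : ℂ → ℂ} (hh : DiffContOnCl ℂ h (ball 0 1))
    (hconj : ∀ s ∈ sphere (0 : ℂ) 1, h (conj s) = conj (h s))
    (hpos : ∀ s ∈ sphere (0 : ℂ) 1, 0 ≤ s.im * (h s).im) :
    ∃ ν : FiniteMeasure (Icc (-1 : ℝ) 1), ∀ ζ ∈ ball (0 : ℂ) 1,
      h ζ - h 0 = ∫ x : Icc (-1 : ℝ) 1, ζ / (1 - 2 * ζ * ((x : ℝ) : ℂ) + ζ ^ 2) ∂(ν : Measure _) := by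
  have hcont : ContinuousOn h (sphere 0 1) := by
    have := hh.continuousOn
    rw [closure_ball _ one_ne_zero] at this
    exact this.mono sphere_subset_closedBall
  have hmem : ∀ θ : ℝ, circleMap 0 1 θ ∈ sphere (0 : ℂ) 1 := circleMap_mem_sphere 0 zero_le_one
  set p : ℝ → ℝ := fun θ =>
    (2 * π)⁻¹ * (2 * ((circleMap 0 1 θ).im * (h (circleMap 0 1 θ)).im)) with hp
  have hpcont : Continuous p := by
    have h1 : Continuous fun θ => h (circleMap 0 1 θ) :=
      hcont.comp_continuous (continuous_circleMap 0 1) hmem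
    exact continuous_const.mul (continuous_const.mul
      ((Complex.continuous_im.comp (continuous_circleMap 0 1)).mul (Complex.continuous_im.comp h1)))
  have hp0 : ∀ θ, 0 ≤ p θ := fun θ =>
    mul_nonneg (by positivity) (mul_nonneg zero_le_two (hpos _ (hmem θ)))
  set m : Measure ℝ := (volume.restrict (Ioc 0 (2 * π))).withDensity
    fun θ => ENNReal.ofReal (p θ) with hm
  have hfin : IsFiniteMeasure m :=
    isFiniteMeasure_withDensity_ofReal
      (hpcont.integrableOn_Ioc (μ := volume) (a := 0) (b := 2 * π)).hasFiniteIntegral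
  -- The kernel depends on `s = exp (i θ)` only through `Re s = cos θ`, so the positive boundary
  -- density can be pushed forward to `[-1, 1]`.
  set τ : ℝ → Icc (-1 : ℝ) 1 := fun θ => ⟨Real.cos θ, Real.cos_mem_Icc θ⟩ with hτ
  have hτm : Measurable τ := by fun_prop
  have hfin' : IsFiniteMeasure (m.map τ) := inferInstance
  refine ⟨⟨m.map τ, hfin'⟩, fun ζ hζ => ?_⟩
  rw [sub_eq_circleAverage_of_conj hh hconj hζ, FiniteMeasure.toMeasure_mk]
  have hmeas : Measurable fun x : Icc (-1 : ℝ) 1 => ζ / (1 - 2 * ζ * ((x : ℝ) : ℂ) + ζ ^ 2) := by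
    fun_prop
  rw [integral_map hτm.aemeasurable hmeas.aestronglyMeasurable, hm,
    integral_withDensity_eq_integral_toReal_smul (by fun_prop)
      (Eventually.of_forall fun _ => ENNReal.ofReal_lt_top), circleAverage_def,
    intervalIntegral.integral_of_le (by positivity), ← integral_smul]
  refine integral_congr_ae (Eventually.of_forall fun θ => ?_)
  dsimp only
  rw [ENNReal.toReal_ofReal (hp0 θ), hp, Complex.real_smul, Complex.real_smul]
  push_cast
  have hre : (circleMap 0 1 θ).re = Real.cos θ := by simp [circleMap, Complex.exp_ofReal_mul_I_re]
  rw [hre]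
  ring

/-- For `x = cos θ` the roots are `exp (± i θ)`, on the unit circle. In the proof, a vanishing
imaginary part forces `ζ` real or `Re ζ = x`, and each case contradicts `‖ζ‖ < 1`. -/
theorem one_sub_two_mul_add_sq_ne_zero {ζ : ℂ} (hζ : ζ ∈ Metric.ball (0 : ℂ) 1) {x : ℝ}
    (hx : x ∈ Icc (-1 : ℝ) 1) : 1 - 2 * ζ * (x : ℂ) + ζ ^ 2 ≠ 0 := by
  intro h0
  have hn : ζ.re ^ 2 + ζ.im ^ 2 < 1 := by
    have h1 : ‖ζ‖ < 1 := by simpa using hζ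
    have h2 : ζ.re ^ 2 + ζ.im ^ 2 = ‖ζ‖ ^ 2 := by
      rw [Complex.sq_norm, Complex.normSq_apply]
      ring
    rw [h2]
    exact pow_lt_one₀ (norm_nonneg _) h1 two_ne_zero
  have hre := congrArg Complex.re h0
  have him := congrArg Complex.im h0
  simp [pow_two] at hre him
  rcases mul_eq_zero.1 (show ζ.im * (ζ.re - x) = 0 by linarith) with h | h
  · rw [h] at hre hn
    have h3 : ζ.re * x ≤ |ζ.re| := by
      calc ζ.re * x ≤ |ζ.re * x| := le_abs_self _
        _ = |ζ.re| * |x| := abs_mul _ _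
        _ ≤ |ζ.re| * 1 := mul_le_mul_of_nonneg_left (abs_le.2 hx) (abs_nonneg _)
        _ = |ζ.re| := mul_one _
    have h4 : |ζ.re| ^ 2 = ζ.re ^ 2 := sq_abs _
    have h5 : |ζ.re| < 1 := by
      rw [← sq_lt_one_iff₀ (abs_nonneg _), h4]
      linarith
    nlinarith
  · have h3 : x = ζ.re := by linarith
    rw [h3] at hre
    nlinarith

open ComplexConjugate Metric NNReal in
/-- A typically real function on the open unit disc is represented by a measure on `[-1, 1]`. -/
theorem exists_measure_of_typically_real {g : ℂ → ℂ} (hg : DifferentiableOn ℂ g (ball 0 1))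
    (hconj : ∀ ζ ∈ ball (0 : ℂ) 1, g (conj ζ) = conj (g ζ))
    (hpos : ∀ ζ ∈ ball (0 : ℂ) 1, 0 ≤ ζ.im * (g ζ).im) :
    ∃ ν : FiniteMeasure (Icc (-1 : ℝ) 1), ∀ ζ ∈ ball (0 : ℂ) 1,
      g ζ - g 0 = ∫ x : Icc (-1 : ℝ) 1, ζ / (1 - 2 * ζ * ((x : ℝ) : ℂ) + ζ ^ 2) ∂(ν : Measure _) := by
  -- The dilations `g (r n * ζ)` are continuous up to the circle; `n + 2` keeps `r 0` positive.
  set r : ℕ → ℝ := fun n => 1 - 1 / ((n : ℝ) + 2) with hr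
  have hr0 : ∀ n, 0 < r n := fun n => by
    rw [hr, sub_pos, div_lt_one (by positivity)]
    have : (0 : ℝ) ≤ n := n.cast_nonneg
    linarith
  have hr1 : ∀ n, r n < 1 := fun n => sub_lt_self _ (by positivity)
  have hrlim : Tendsto r atTop (𝓝 1) := by
    have h1 : Tendsto (fun n : ℕ => 1 / ((n : ℝ) + 2)) atTop (𝓝 0) :=
      tendsto_const_nhds.div_atTop (tendsto_atTop_add_const_right _ _ tendsto_natCast_atTop_atTop)
    have h2 := h1.const_sub 1
    rwa [sub_zero] at h2
  have hmem : ∀ n, ∀ z : ℂ, ‖z‖ ≤ 1 → (r n : ℂ) * z ∈ ball (0 : ℂ) 1 := fun n z hz => by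
    rw [mem_ball_zero_iff, norm_mul, Complex.norm_real, Real.norm_eq_abs, abs_of_pos (hr0 n)]
    nlinarith [hr0 n, hr1 n]
  have hex : ∀ n, ∃ ν : FiniteMeasure (Icc (-1 : ℝ) 1), ∀ ζ ∈ ball (0 : ℂ) 1,
      g (r n * ζ) - g 0 =
        ∫ x : Icc (-1 : ℝ) 1, ζ / (1 - 2 * ζ * ((x : ℝ) : ℂ) + ζ ^ 2) ∂(ν : Measure _) := fun n => by
    have hd : DiffContOnCl ℂ (fun ζ => g (r n * ζ)) (ball 0 1) := by
      refine DifferentiableOn.diffContOnCl ?_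
      rw [closure_ball _ one_ne_zero]
      refine hg.comp (by fun_prop) fun z hz => hmem n z (by simpa using hz)
    have := exists_measure_of_closedBall hd (fun s hs => ?_) (fun s hs => ?_)
    · simpa only [mul_zero] using this
    · have hs' : ‖s‖ ≤ 1 := (by simpa using hs : ‖s‖ = 1).le
      rw [← hconj _ (hmem n s hs'), map_mul, Complex.conj_ofReal]
    · have hs' : ‖s‖ ≤ 1 := (by simpa using hs : ‖s‖ = 1).le
      have h1 := hpos _ (hmem n s hs')
      rw [Complex.im_ofReal_mul, mul_assoc] at h1
      exact (mul_nonneg_iff_of_pos_left (hr0 n)).1 h1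
  choose ν hν using hex
  have hhalf : (1 / 2 : ℂ) ∈ ball (0 : ℂ) 1 := by
    rw [mem_ball_zero_iff]
    norm_num
  -- At `ζ = 1/2` the kernel is `(1/2) / (5/4 - x) ≥ 2/9`, so the masses are at most `9/2` times a
  -- bound for `g (r n / 2) - g 0`.
  obtain ⟨C, hC⟩ : ∃ C : ℝ≥0, ∀ n, (ν n).mass ≤ C := by
    have hcont : ContinuousOn (fun z => g (z * (1 / 2)) - g 0) (closedBall 0 1) := by
      refine (hg.continuousOn.comp (by fun_prop) fun z hz => ?_).sub continuousOn_const
      rw [mem_closedBall_zero_iff] at hz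
      rw [mem_ball_zero_iff, norm_mul]
      norm_num
      linarith
    obtain ⟨C, hC⟩ := (isCompact_closedBall (0 : ℂ) 1).exists_bound_of_continuousOn hcont
    refine ⟨Real.toNNReal (9 / 2 * C), fun n => ?_⟩
    rw [← NNReal.coe_le_coe]
    refine le_trans ?_ (Real.le_coe_toNNReal _)
    have h1 := hC (r n) (by
      rw [mem_closedBall_zero_iff, Complex.norm_real, Real.norm_eq_abs, abs_of_pos (hr0 n)]
      exact (hr1 n).le)
    have h2 : g (r n * (1 / 2)) - g 0 =
        ((∫ x : Icc (-1 : ℝ) 1, (1 / 2) / (5 / 4 - (x : ℝ)) ∂(ν n : Measure _) : ℝ) : ℂ) := by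
      rw [hν n _ hhalf, ← integral_complex_ofReal]
      congr 1
      ext x
      push_cast
      congr 1
      ring
    rw [h2, Complex.norm_real, Real.norm_eq_abs] at h1
    have hpos' : ∀ x : Icc (-1 : ℝ) 1, 0 < 5 / 4 - (x : ℝ) := fun x => by linarith [x.2.2]
    have h3 : ∫ _ : Icc (-1 : ℝ) 1, (2 / 9 : ℝ) ∂(ν n : Measure _) ≤
        ∫ x : Icc (-1 : ℝ) 1, (1 / 2) / (5 / 4 - (x : ℝ)) ∂(ν n : Measure _) := by
      refine integral_mono (integrable_const _) ?_ fun x => ?_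
      · exact (BoundedContinuousFunction.mkOfCompact
          ⟨fun x : Icc (-1 : ℝ) 1 => (1 / 2) / (5 / 4 - (x : ℝ)),
            continuous_const.div (by fun_prop) fun x => (hpos' x).ne'⟩).integrable _
      · dsimp only
        rw [div_le_div_iff₀ (by norm_num) (hpos' x)]
        linarith [x.2.1]
    rw [integral_const, smul_eq_mul] at h3
    have h4 : (ν n : Measure (Icc (-1 : ℝ) 1)).real univ = ((ν n).mass : ℝ) := rfl
    rw [h4] at h3
    linarith [le_abs_self (∫ x : Icc (-1 : ℝ) 1, (1 / 2) / (5 / 4 - (x : ℝ)) ∂(ν n : Measure _))]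
  -- Measures on `[-1, 1]` of mass at most `C` form a weakly compact set; a limit along an
  -- ultrafilter replaces a convergent subsequence.
  obtain ⟨ν', -, hν'⟩ := (isCompact_setOfPred_finiteMeasure_le_of_compactSpace
    (Icc (-1 : ℝ) 1) C).ultrafilter_le_nhds ((Filter.hyperfilter ℕ).map ν) (by
      rw [le_principal_iff]
      exact Filter.mem_map.2 (Eventually.of_forall hC))
  refine ⟨ν', fun ζ hζ => ?_⟩
  have hU : (Filter.hyperfilter ℕ : Filter ℕ) ≤ atTop := by
    rw [← Nat.cofinite_eq_atTop]
    exact Filter.hyperfilter_le_cofinite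
  have hlim : Tendsto ν (Filter.hyperfilter ℕ : Filter ℕ) (𝓝 ν') := hν'
  have h1 := (FiniteMeasure.tendsto_iff_forall_integral_rclike_tendsto ℂ).1 hlim
    (BoundedContinuousFunction.mkOfCompact
      ⟨fun x : Icc (-1 : ℝ) 1 => ζ / (1 - 2 * ζ * ((x : ℝ) : ℂ) + ζ ^ 2),
        continuous_const.div (by fun_prop) fun x => one_sub_two_mul_add_sq_ne_zero hζ x.2⟩)
  have h2 : Tendsto (fun n => g (r n * ζ) - g 0) atTop (𝓝 (g ζ - g 0)) := by
    have h3 : Tendsto (fun n => (r n : ℂ) * ζ) atTop (𝓝 ζ) := by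
      have := ((Complex.continuous_ofReal.tendsto 1).comp hrlim).mul_const ζ
      simpa using this
    have h4 : ContinuousAt g ζ := hg.continuousOn.continuousAt (isOpen_ball.mem_nhds hζ)
    exact (h4.tendsto.comp h3).sub_const _
  refine tendsto_nhds_unique (h2.mono_left hU) ?_
  refine h1.congr fun n => ?_
  exact (hν n ζ hζ).symm

/-! ### Transfer to the slit plane -/

theorem one_add_ne_zero_of_mem_ball {ζ : ℂ} (hζ : ζ ∈ Metric.ball (0 : ℂ) 1) : 1 + ζ ≠ 0 := by
  intro h
  have h1 : ζ = -1 := by linear_combination h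
  simp [h1] at hζ

/-- The conformal map `ζ ↦ -((1 - ζ) / (1 + ζ))²` of the unit disc onto `ℂ \ [0, ∞)`. -/
def discToSlit (ζ : ℂ) : ℂ := -((1 - ζ) / (1 + ζ)) ^ 2

/-- The real part is `(1 - |ζ|²) / |1 + ζ|²` and the imaginary part `-2 Im ζ / |1 + ζ|²`. -/
theorem cayley_re_im {ζ : ℂ} (hζ : ζ ∈ Metric.ball (0 : ℂ) 1) :
    0 < ((1 - ζ) / (1 + ζ)).re ∧
      ∃ k : ℝ, 0 < k ∧ ((1 - ζ) / (1 + ζ)).im = -(k * ζ.im) := by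
  have h0 : 0 < Complex.normSq (1 + ζ) := Complex.normSq_pos.2 (one_add_ne_zero_of_mem_ball hζ)
  have h1 : Complex.normSq ζ < 1 := by
    rw [Complex.normSq_eq_norm_sq]
    exact pow_lt_one₀ (norm_nonneg _) (by simpa using hζ) two_ne_zero
  rw [Complex.normSq_apply] at h1
  refine ⟨?_, 2 / Complex.normSq (1 + ζ), by positivity, ?_⟩
  · rw [Complex.div_re, ← add_div]
    refine div_pos ?_ h0
    simp
    nlinarith
  · rw [Complex.div_im, ← sub_div]
    rw [div_mul_eq_mul_div, ← neg_div]
    congr 1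
    simp
    ring

/-- The map preserves the sign of the imaginary part, so the condition on `Im w * Im φ(w)` becomes
typical realness on the disc. -/
theorem discToSlit_im {ζ : ℂ} (hζ : ζ ∈ Metric.ball (0 : ℂ) 1) :
    ∃ k : ℝ, 0 < k ∧ (discToSlit ζ).im = k * ζ.im := by
  obtain ⟨hre, k, hk, him⟩ := cayley_re_im hζ
  refine ⟨2 * ((1 - ζ) / (1 + ζ)).re * k, by positivity, ?_⟩
  rw [discToSlit, pow_two, Complex.neg_im, Complex.mul_im, him]
  ring

theorem discToSlit_mem {ζ : ℂ} (hζ : ζ ∈ Metric.ball (0 : ℂ) 1) :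
    discToSlit ζ ∈ (Complex.ofReal '' Ici 0)ᶜ := by
  obtain ⟨k, hk, him⟩ := discToSlit_im hζ
  rw [mem_slit_iff]
  by_cases h : ζ.im = 0
  · left
    obtain ⟨hre, l, hl, him'⟩ := cayley_re_im hζ
    rw [discToSlit, pow_two, Complex.neg_re, Complex.mul_re, him', h]
    nlinarith
  · right
    rw [him]
    exact mul_ne_zero hk.ne' h

/-- Off `[0, ∞)`, `-w` has a square root `q` with positive real part, and the involution `q ↦ (1 -
q) / (1 + q)` takes it into the disc. -/
theorem exists_discToSlit_eq {w : ℂ} (hw : w ∈ (Complex.ofReal '' Ici 0)ᶜ) :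
    ∃ ζ ∈ Metric.ball (0 : ℂ) 1, discToSlit ζ = w := by
  obtain ⟨q, hq⟩ := IsAlgClosed.exists_pow_nat_eq (-w) (n := 2) two_pos
  obtain ⟨q, hq, hq0⟩ : ∃ q : ℂ, q ^ 2 = -w ∧ 0 < q.re := by
    rcases lt_trichotomy q.re 0 with h | h | h
    · exact ⟨-q, by rw [neg_sq, hq], by simpa using h⟩
    · exfalso
      have hw' : w = -(q ^ 2) := by rw [hq, neg_neg]
      rw [mem_slit_iff, hw', pow_two] at hw
      simp [h] at hw
      nlinarith [mul_self_nonneg q.im]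
    · exact ⟨q, hq, h⟩
  have h1 : 1 + q ≠ 0 := fun h => by
    have := congrArg Complex.re h
    simp at this
    linarith
  refine ⟨(1 - q) / (1 + q), ?_, ?_⟩
  · rw [mem_ball_zero_iff, norm_div, div_lt_one (norm_pos_iff.2 h1), ← sq_lt_sq₀ (norm_nonneg _)
      (norm_nonneg _), Complex.sq_norm, Complex.sq_norm, Complex.normSq_apply,
      Complex.normSq_apply]
    simp
    nlinarith
  · have h2 : (1 - (1 - q) / (1 + q)) / (1 + (1 - q) / (1 + q)) = q := by
      have h3 : 1 + (1 - q) / (1 + q) ≠ 0 := by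
        rw [one_add_div h1]
        refine div_ne_zero ?_ h1
        ring_nf
        norm_num
      rw [div_eq_iff h3]
      field_simp
      ring
    rw [discToSlit, h2, hq, neg_neg]

open ComplexConjugate in
theorem discToSlit_conj (ζ : ℂ) : discToSlit (conj ζ) = conj (discToSlit ζ) := by
  simp [discToSlit]

theorem discToSlit_zero : discToSlit 0 = ((-1 : ℝ) : ℂ) := by
  simp [discToSlit]

/-! ### Reflection symmetry of `φ` and its representation on `[-1, 1]` -/

namespace IsNegCompleteBernstein

variable {φ : ℂ → ℂ}

/-- `Im φ` is nonnegative above the negative axis and nonpositive below it, so it vanishes there by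
continuity. -/
theorem im_ofReal_eq_zero (hφ : IsNegCompleteBernstein φ) {x : ℝ} (hx : x < 0) :
    (φ x).im = 0 := by
  have hmem : ∀ y : ℝ, (x : ℂ) + y * Complex.I ∈ (Complex.ofReal '' Ici 0)ᶜ := fun y =>
    mem_slit_iff.2 (Or.inl (by simpa using hx))
  have hcont : Tendsto (fun y : ℝ => (φ (x + y * Complex.I)).im) (𝓝 0) (𝓝 (φ x).im) := by
    have h1 : ContinuousAt φ ((x : ℂ) + (0 : ℝ) * Complex.I) :=
      hφ.differentiableOn.continuousOn.continuousAt (isOpen_slit.mem_nhds (hmem 0))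
    have h2 : Tendsto (fun y : ℝ => (x : ℂ) + y * Complex.I) (𝓝 0)
        (𝓝 ((x : ℂ) + (0 : ℝ) * Complex.I)) :=
      Continuous.tendsto (f := fun y : ℝ => (x : ℂ) + y * Complex.I) (by fun_prop) 0
    have h3 := (Complex.continuous_im.tendsto _).comp (h1.tendsto.comp h2)
    simpa [Function.comp_def] using h3
  have hpos : ∀ y : ℝ, 0 ≤ y * (φ (x + y * Complex.I)).im := fun y => by
    simpa using hφ.im_mul_im_nonneg _ (hmem y)
  refine le_antisymm ?_ ?_
  · refine le_of_tendsto (hcont.mono_left (nhdsWithin_le_nhds (s := Iio 0))) ?_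
    filter_upwards [self_mem_nhdsWithin] with y hy
    exact nonpos_of_mul_nonneg_right (hpos y) hy
  · refine ge_of_tendsto (hcont.mono_left (nhdsWithin_le_nhds (s := Ioi 0))) ?_
    filter_upwards [self_mem_nhdsWithin] with y hy
    exact nonneg_of_mul_nonneg_right (hpos y) hy

theorem differentiableOn_comp_discToSlit (hφ : IsNegCompleteBernstein φ) :
    DifferentiableOn ℂ (fun ζ => φ (discToSlit ζ)) (Metric.ball 0 1) := by
  refine hφ.differentiableOn.comp (fun ζ hζ => ?_) fun ζ hζ => discToSlit_mem hζ
  have := one_add_ne_zero_of_mem_ball hζ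
  unfold discToSlit
  exact DifferentiableAt.differentiableWithinAt (by fun_prop (disch := assumption))

open ComplexConjugate Metric in
-- Schwarz reflection: both sides, suitably conjugated, are holomorphic and agree at real points
-- near `0`.
theorem comp_discToSlit_conj (hφ : IsNegCompleteBernstein φ) {ζ : ℂ} (hζ : ζ ∈ ball (0 : ℂ) 1) :
    φ (discToSlit (conj ζ)) = conj (φ (discToSlit ζ)) := by
  set g : ℂ → ℂ := fun ζ => φ (discToSlit ζ) with hg
  have hgd : DifferentiableOn ℂ g (ball 0 1) := hφ.differentiableOn_comp_discToSlit
  have hgd' : DifferentiableOn ℂ (conj ∘ g ∘ conj) (ball 0 1) := fun z hz => by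
    have hz' : conj z ∈ ball (0 : ℂ) 1 := by simpa using hz
    have := (hgd.differentiableAt (isOpen_ball.mem_nhds hz')).conj_conj
    rw [Complex.conj_conj] at this
    exact this.differentiableWithinAt
  have hball : ball (0 : ℂ) 1 ∈ 𝓝 (0 : ℂ) := ball_mem_nhds 0 one_pos
  have heq : EqOn g (conj ∘ g ∘ conj) (ball 0 1) := by
    refine (hgd.analyticOnNhd isOpen_ball).eqOn_of_preconnected_of_frequently_eq
      (hgd'.analyticOnNhd isOpen_ball) (convex_ball 0 1).isPreconnected (mem_ball_self one_pos) ?_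
    have hlim : Tendsto (fun x : ℝ => (x : ℂ)) (𝓝[≠] 0) (𝓝[≠] 0) := by
      refine tendsto_nhdsWithin_iff.2 ⟨?_, ?_⟩
      · exact (Complex.continuous_ofReal.tendsto 0).mono_left nhdsWithin_le_nhds
      · filter_upwards [self_mem_nhdsWithin] with x hx
        simpa using hx
    refine hlim.frequently (Eventually.frequently ?_)
    have h1 : ∀ᶠ x : ℝ in 𝓝[≠] 0, (x : ℂ) ∈ ball (0 : ℂ) 1 :=
      hlim.eventually (nhdsWithin_le_nhds hball)
    filter_upwards [h1] with x hx
    have h2 : (discToSlit x).im = 0 := by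
      obtain ⟨k, -, hk⟩ := discToSlit_im hx
      simpa using hk
    have h3 : (discToSlit x).re < 0 := by
      have := mem_slit_iff.1 (discToSlit_mem hx)
      simpa [h2] using this
    have h4 : discToSlit x = ((discToSlit x).re : ℂ) := Complex.ext rfl (by simp [h2])
    have h5 : (g x).im = 0 := by
      rw [hg]
      dsimp only
      rw [h4]
      exact hφ.im_ofReal_eq_zero h3
    simp only [Function.comp_apply, Complex.conj_ofReal]
    exact (Complex.conj_eq_iff_im.2 h5).symm
  have h := heq (x := conj ζ) (by simpa using hζ)
  simpa [hg] using h

/-- The representation of `φ` by a measure on `[-1, 1]`, in the variable `w`. -/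
theorem exists_measure (hφ : IsNegCompleteBernstein φ) :
    ∃ ν : Measure ℝ, IsFiniteMeasure ν ∧ (∀ᵐ x ∂ν, x ∈ Icc (-1 : ℝ) 1) ∧
      ∀ w ∈ (Complex.ofReal '' Ici 0)ᶜ, φ w - φ ((-1 : ℝ) : ℂ) =
        ∫ x : ℝ, (w + 1) / (2 * ((1 - x) - (1 + x) * w)) ∂ν := by
  obtain ⟨ν, hν⟩ := exists_measure_of_typically_real hφ.differentiableOn_comp_discToSlit
    (fun ζ hζ => hφ.comp_discToSlit_conj hζ) fun ζ hζ => by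
      obtain ⟨k, hk, hk'⟩ := discToSlit_im hζ
      have := hφ.im_mul_im_nonneg _ (discToSlit_mem hζ)
      rw [hk', mul_assoc] at this
      exact (mul_nonneg_iff_of_pos_left hk).1 this
  refine ⟨(ν : Measure (Icc (-1 : ℝ) 1)).map Subtype.val, inferInstance, ?_, fun w hw => ?_⟩
  · exact (ae_map_iff (p := fun x => x ∈ Icc (-1 : ℝ) 1) measurable_subtype_coe.aemeasurable
      measurableSet_Icc).2 (Eventually.of_forall fun x => x.2)
  · obtain ⟨ζ, hζ, rfl⟩ := exists_discToSlit_eq hw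
    have hmeas : Measurable fun x : ℝ =>
        (discToSlit ζ + 1) / (2 * ((1 - (x : ℂ)) - (1 + x) * discToSlit ζ)) := by fun_prop
    rw [integral_map measurable_subtype_coe.aemeasurable hmeas.aestronglyMeasurable,
      ← discToSlit_zero, hν ζ hζ]
    congr 1
    ext x
    have h1 := one_add_ne_zero_of_mem_ball hζ
    have h2 := one_sub_two_mul_add_sq_ne_zero hζ x.2
    have h3 : discToSlit ζ + 1 = 4 * ζ / (1 + ζ) ^ 2 := by
      rw [discToSlit]
      field_simp
      ring
    have h4 : (1 - ((x : ℝ) : ℂ)) - (1 + ((x : ℝ) : ℂ)) * discToSlit ζ =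
        2 * (1 - 2 * ζ * ((x : ℝ) : ℂ) + ζ ^ 2) / (1 + ζ) ^ 2 := by
      rw [discToSlit]
      field_simp
      ring
    rw [h3, h4]
    generalize 1 - 2 * ζ * ((x : ℝ) : ℂ) + ζ ^ 2 = D at *
    field_simp
    norm_num

end IsNegCompleteBernstein

/-! ### From the measure on `[-1, 1]` to the triple `(c, b, μ)` -/

/-- The measure on `(0, ∞)` obtained from a measure `ν` on `(-1, 1)` by the substitution
`t = (1 - x) / (1 + x)` and the density `(1 - x²)⁻¹`. -/
def halfLineMeasure (ν : Measure ℝ) : Measure ℝ :=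
  ((ν.restrict (Ioo (-1) 1)).withDensity fun x => ENNReal.ofReal (1 - x ^ 2)⁻¹).map
    fun x => (1 - x) / (1 + x)

theorem halfLineMeasure_restrict (ν : Measure ℝ) :
    (halfLineMeasure ν).restrict (Ioi 0) = halfLineMeasure ν := by
  refine Measure.restrict_eq_self_of_ae_mem ?_
  refine (ae_map_iff (p := fun t => t ∈ Ioi (0 : ℝ)) (by fun_prop) measurableSet_Ioi).2 ?_
  refine (withDensity_absolutelyContinuous _ _).ae_le ?_
  refine (ae_restrict_iff' measurableSet_Ioo).2 (Eventually.of_forall fun x hx => ?_)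
  exact div_pos (sub_pos.2 hx.2) (by linarith [hx.1] : 0 < 1 + x)

theorem inv_one_sub_sq_nonneg {x : ℝ} (hx : x ∈ Ioo (-1 : ℝ) 1) : 0 ≤ (1 - x ^ 2)⁻¹ :=
  inv_nonneg.2 (by nlinarith [hx.1, hx.2])

variable {E : Type*} [NormedAddCommGroup E] [NormedSpace ℝ E]

theorem integrableOn_halfLineMeasure {ν : Measure ℝ} {G : ℝ → E} (hG : StronglyMeasurable G)
    (h : IntegrableOn (fun x => (1 - x ^ 2)⁻¹ • G ((1 - x) / (1 + x))) (Ioo (-1) 1) ν) :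
    IntegrableOn G (Ioi 0) (halfLineMeasure ν) := by
  rw [IntegrableOn, halfLineMeasure_restrict, halfLineMeasure,
    integrable_map_measure hG.aestronglyMeasurable (by fun_prop),
    integrable_withDensity_iff_integrable_smul' (by fun_prop)
      (Eventually.of_forall fun _ => ENNReal.ofReal_lt_top)]
  refine h.congr_fun (fun x hx => ?_) measurableSet_Ioo
  simp only [Function.comp_apply, ENNReal.toReal_ofReal (inv_one_sub_sq_nonneg hx)]

theorem integral_halfLineMeasure {ν : Measure ℝ} {G : ℝ → E} (hG : StronglyMeasurable G) :
    ∫ t in Ioi (0 : ℝ), G t ∂(halfLineMeasure ν) =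
      ∫ x in Ioo (-1 : ℝ) 1, (1 - x ^ 2)⁻¹ • G ((1 - x) / (1 + x)) ∂ν := by
  rw [halfLineMeasure_restrict, halfLineMeasure,
    integral_map (by fun_prop) hG.aestronglyMeasurable,
    integral_withDensity_eq_integral_toReal_smul (by fun_prop)
      (Eventually.of_forall fun _ => ENNReal.ofReal_lt_top)]
  refine setIntegral_congr_fun measurableSet_Ioo (fun x hx => ?_)
  simp only [ENNReal.toReal_ofReal (inv_one_sub_sq_nonneg hx)]

/-- For a measure on `[-1, 1]`, boundedness of the integral of the kernel as `w → 0-` forces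
integrability of `(1 - x)⁻¹` and the absence of mass at `1`. -/
theorem integrable_inv_of_tendsto_kernel {ν : Measure ℝ} [IsFiniteMeasure ν]
    (hν : ∀ᵐ x ∂ν, x ∈ Icc (-1 : ℝ) 1) {f : ℝ → ℝ} {c : ℝ} (hf : Tendsto f (𝓝[<] 0) (𝓝 c))
    (hrep : ∀ y < 0, f y = ∫ x : ℝ, (y + 1) / (2 * ((1 - x) - (1 + x) * y)) ∂ν) :
    ν {1} = 0 ∧ Integrable (fun x : ℝ => (2 * (1 - x))⁻¹) ν := by
  set y : ℕ → ℝ := fun n => -(1 / ((n : ℝ) + 1)) with hy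
  have hy0 : ∀ n, y n < 0 := fun n => neg_lt_zero.2 Nat.one_div_pos_of_nat
  have hy1 : ∀ n, -1 ≤ y n := fun n => by
    refine neg_le_neg ?_
    rw [div_le_one (by positivity)]
    have : (0 : ℝ) ≤ n := n.cast_nonneg
    linarith
  have hylim : Tendsto y atTop (𝓝 0) := by
    have := (tendsto_one_div_add_atTop_nhds_zero_nat (𝕜 := ℝ)).neg
    rwa [neg_zero] at this
  have hflim : Tendsto (fun n => f (y n)) atTop (𝓝 c) :=
    hf.comp (tendsto_nhdsWithin_iff.2 ⟨hylim, Eventually.of_forall hy0⟩)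
  set k : ℕ → ℝ → ℝ := fun n x => (y n + 1) / (2 * ((1 - x) - (1 + x) * y n)) with hk
  -- Twice the difference of the two sides is `(1 - x) (1 + y n) ≥ 0`; this is why `y n ≥ -1` is
  -- needed.
  have hD : ∀ n, ∀ x ∈ Icc (-1 : ℝ) 1, -y n ≤ ((1 - x) - (1 + x) * y n) / 2 := fun n x hx => by
    nlinarith [hx.1, hx.2, hy0 n, hy1 n,
      mul_nonneg (sub_nonneg.2 hx.2) (by linarith [hy1 n] : 0 ≤ 1 + y n)]
  have hk0 : ∀ n, 0 ≤ᵐ[ν] k n := fun n => by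
    filter_upwards [hν] with x hx
    exact div_nonneg (by linarith [hy1 n]) (by linarith [hD n x hx, hy0 n])
  have hkint : ∀ n, Integrable (k n) ν := fun n => by
    refine Integrable.of_bound (C := (y n + 1) / (-(4 * y n)))
      (Measurable.aestronglyMeasurable (by fun_prop)) ?_
    filter_upwards [hν, hk0 n] with x hx h0
    rw [Real.norm_eq_abs, abs_of_nonneg h0]
    exact div_le_div_of_nonneg_left (by linarith [hy1 n]) (by linarith [hy0 n])
      (by linarith [hD n x hx])
  have hklim : ∀ x < 1, Tendsto (fun n => k n x) atTop (𝓝 (2 * (1 - x))⁻¹) := fun x hx => by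
    have h1 : Tendsto (fun n => k n x) atTop (𝓝 ((0 + 1) / (2 * ((1 - x) - (1 + x) * 0)))) :=
      (hylim.add_const 1).div (tendsto_const_nhds.mul
        (tendsto_const_nhds.sub (tendsto_const_nhds.mul hylim))) (by
          rw [mul_zero, sub_zero]
          exact mul_ne_zero two_ne_zero (sub_pos.2 hx).ne')
    rwa [mul_zero, sub_zero, zero_add, one_div] at h1
  -- `-y` times the kernel tends to `1/4` at `x = 1` and to `0` for `x < 1`, while `-y f(y) → 0`;
  -- Fatou then leaves no mass at `1`.
  have hatom : ν {1} = 0 := by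
    have h := integrable_and_integral_le_of_tendsto (μ := ν) (F := fun n x => -y n * k n x)
      (f := indicator {1} fun _ => (1 / 4 : ℝ)) (fun n => (hkint n).const_mul _)
      (fun n => ?_) ?_ (u := fun n => -y n * f (y n)) (fun n => ?_)
      (c := 0) ?_
    · have h2 := h.2
      rw [integral_indicator (measurableSet_singleton 1), setIntegral_const, smul_eq_mul] at h2
      have h3 : ν.real {1} = 0 := le_antisymm (by linarith) measureReal_nonneg
      exact (measureReal_eq_zero_iff (measure_ne_top ν _)).1 h3
    · filter_upwards [hk0 n] with x hx
      exact mul_nonneg (by linarith [hy0 n]) hx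
    · filter_upwards [hν] with x hx
      rcases eq_or_lt_of_le hx.2 with rfl | hx1
      · rw [indicator_of_mem (mem_singleton _)]
        have h1 : Tendsto (fun n => (y n + 1) / 4) atTop (𝓝 ((0 + 1) / 4)) :=
          (hylim.add_const 1).div_const 4
        rw [zero_add] at h1
        refine h1.congr fun n => ?_
        have := (hy0 n).ne
        simp only [hk]
        rw [show 2 * ((1 : ℝ) - 1 - (1 + 1) * y n) = -(4 * y n) by ring]
        field_simp
      · rw [indicator_of_notMem (by simpa using hx1.ne)]
        have h1 := hylim.neg.mul (hklim x hx1)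
        rwa [neg_zero, zero_mul] at h1
    · rw [integral_const_mul, hrep _ (hy0 n)]
    · have h1 := hylim.neg.mul hflim
      rwa [neg_zero, zero_mul] at h1
  refine ⟨hatom, (integrable_and_integral_le_of_tendsto (F := k) hkint hk0 ?_
    (fun n => (hrep _ (hy0 n)).ge) hflim).1⟩
  have hne : ∀ᵐ x ∂ν, x ≠ 1 := by
    rw [ae_iff]
    simpa using hatom
  filter_upwards [hν, hne] with x hx hx1
  exact hklim x (lt_of_le_of_ne hx.2 hx1)

/-- A zero would give `w = (1 - x) / (1 + x) ∈ [0, ∞)`; for `x = -1` the value is `2`. -/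
theorem one_sub_sub_mul_ne_zero {w : ℂ} (hw : w ∈ (Complex.ofReal '' Ici 0)ᶜ) {x : ℝ}
    (hx : x ∈ Icc (-1 : ℝ) 1) : (1 - (x : ℂ)) - (1 + x) * w ≠ 0 := by
  intro h0
  rcases eq_or_lt_of_le hx.1 with rfl | h1
  · norm_num at h0
  · have h2 : (1 + x : ℂ) ≠ 0 := by
      exact_mod_cast (by linarith : (1 + x) ≠ 0)
    refine hw ⟨(1 - x) / (1 + x), div_nonneg (sub_nonneg.2 hx.2) (by linarith : 0 ≤ 1 + x), ?_⟩
    push_cast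
    rw [div_eq_iff h2]
    linear_combination h0

/-- Every negative complete Bernstein function has an integral representation. -/
theorem IsNegCompleteBernstein.exists_represents {φ : ℂ → ℂ} (hφ : IsNegCompleteBernstein φ) :
    ∃ σ : ReprTriple, σ.Represents φ := by
  obtain ⟨ν, hfin, hν, hrep⟩ := hφ.exists_measure
  obtain ⟨c, hc⟩ := hφ.exists_limit
  have hlim : Tendsto (fun y : ℝ => (φ y).re - (φ ((-1 : ℝ) : ℂ)).re) (𝓝[<] 0)
      (𝓝 (c - (φ ((-1 : ℝ) : ℂ)).re)) :=
    ((Complex.continuous_re.tendsto _).comp hc).sub_const _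
  obtain ⟨hatom, hint⟩ := integrable_inv_of_tendsto_kernel hν hlim fun y hy => by
    rw [← Complex.sub_re, hrep y (ofReal_mem_slit hy), ← Complex.ofReal_re
      (∫ x : ℝ, (y + 1) / (2 * ((1 - x) - (1 + x) * y)) ∂ν), ← integral_complex_ofReal]
    push_cast
    rfl
  have hne : ∀ᵐ x ∂ν, x ≠ 1 := by
    rw [ae_iff]
    simpa using hatom
  have hrestr : ν.restrict (Icc (-1) 1) = ν := Measure.restrict_eq_self_of_ae_mem hν
  -- `c` collects `φ(-1)` and the integral of the kernel at `w = 0`; at `x = -1` the remaining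
  -- kernel `L` equals `w / 4`, whence `b`.
  refine ⟨⟨(φ ((-1 : ℝ) : ℂ)).re + ∫ x : ℝ, (2 * (1 - x))⁻¹ ∂ν, ν.real {-1} / 4,
    halfLineMeasure ν, by positivity, ?_⟩, fun w hw => ?_⟩
  · refine integrableOn_halfLineMeasure (Measurable.stronglyMeasurable (by fun_prop)) ?_
    -- With `t = (1 - x) / (1 + x)`, `(1 - x²)⁻¹ (1 + t)⁻¹ = (2 (1 - x))⁻¹`.
    refine (hint.integrableOn (s := Ioo (-1) 1)).congr_fun (fun x hx => ?_) measurableSet_Ioo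
    have h1 : 1 - x ≠ 0 := by linarith [hx.2]
    have h2 : 1 + x ≠ 0 := by linarith [hx.1]
    have h3 : 1 + (1 - x) / (1 + x) = 2 / (1 + x) := by
      field_simp
      ring
    have h4 : 1 - x ^ 2 = (1 - x) * (1 + x) := by ring
    rw [smul_eq_mul, h3, h4]
    field_simp
  -- `L` is the kernel minus its value at `w = 0`, and on `(-1, 1)` it equals `(1 - x²)⁻¹ w / (t -
  -- w)`, which explains the density.
  · set L : ℝ → ℂ := fun x => w / ((1 - x) * ((1 - x) - (1 + x) * w)) with hL
    have hK : Integrable (fun x : ℝ => (w + 1) / (2 * ((1 - (x : ℂ)) - (1 + x) * w))) ν := by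
      rw [← hrestr]
      refine ContinuousOn.integrableOn_compact isCompact_Icc ?_
      exact continuousOn_const.div (by fun_prop) fun x hx =>
        mul_ne_zero two_ne_zero (one_sub_sub_mul_ne_zero hw hx)
    have hint' : Integrable (fun x : ℝ => (((2 * (1 - x))⁻¹ : ℝ) : ℂ)) ν := hint.ofReal
    have hKL : (fun x : ℝ => (w + 1) / (2 * ((1 - (x : ℂ)) - (1 + x) * w)) -
        (((2 * (1 - x))⁻¹ : ℝ) : ℂ)) =ᵐ[ν] L := by
      filter_upwards [hν, hne] with x hx hx1
      have h1 : (1 - (x : ℂ)) ≠ 0 := by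
        rw [sub_ne_zero]
        exact_mod_cast hx1.symm
      have h2 := one_sub_sub_mul_ne_zero hw hx
      rw [hL]
      push_cast
      have h3 : (w + 1) * (1 - (x : ℂ)) = ((1 - (x : ℂ)) - (1 + x) * w) + 2 * w := by ring
      generalize (1 - (x : ℂ)) - (1 + x) * w = D at *
      field_simp
      linear_combination h3
    have hLint : Integrable L ν := (hK.sub hint').congr hKL
    have hsplit : ∫ x, L x ∂ν = ν.real {-1} * (w / 4) + ∫ x in Ioo (-1 : ℝ) 1, L x ∂ν := by
      have h1 : ∫ x, L x ∂ν = ∫ x in Ico (-1 : ℝ) 1, L x ∂ν := by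
        rw [Measure.restrict_eq_self_of_ae_mem]
        filter_upwards [hν, hne] with x hx hx1
        exact ⟨hx.1, lt_of_le_of_ne hx.2 hx1⟩
      have h2 : Ico (-1 : ℝ) 1 = {-1} ∪ Ioo (-1) 1 := by
        rw [← Ioo_union_left (by norm_num : (-1 : ℝ) < 1), union_comm]
      rw [h1, h2, setIntegral_union (by simp) measurableSet_Ioo hLint.integrableOn
        hLint.integrableOn, Measure.restrict_singleton, integral_smul_measure, integral_dirac,
        hL, ← measureReal_def, Complex.real_smul]
      norm_num
    have hIoo : ∫ x in Ioo (-1 : ℝ) 1, L x ∂ν =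
        ∫ t in Ioi (0 : ℝ), w / ((t : ℂ) - w) ∂(halfLineMeasure ν) := by
      rw [integral_halfLineMeasure (Measurable.stronglyMeasurable (by fun_prop))]
      refine setIntegral_congr_fun measurableSet_Ioo fun x hx => ?_
      have h1 : (1 - (x : ℂ)) ≠ 0 := by
        exact_mod_cast (by linarith [hx.2] : 1 - x ≠ 0)
      have h2 : (1 + (x : ℂ)) ≠ 0 := by
        exact_mod_cast (by linarith [hx.1] : 1 + x ≠ 0)
      have h3 := one_sub_sub_mul_ne_zero hw ⟨hx.1.le, hx.2.le⟩
      rw [hL, Complex.real_smul]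
      push_cast
      have h4 : (1 - (x : ℂ)) / (1 + x) - w = ((1 - (x : ℂ)) - (1 + x) * w) / (1 + x) := by
        field_simp
      have h5 : 1 - (x : ℂ) ^ 2 = (1 - x) * (1 + x) := by ring
      rw [h4, h5]
      field_simp
    have hφ1 : φ ((-1 : ℝ) : ℂ) = ((φ ((-1 : ℝ) : ℂ)).re : ℂ) :=
      Complex.ext rfl (hφ.im_ofReal_eq_zero (by norm_num))
    have h1 : φ w = φ ((-1 : ℝ) : ℂ) + ((∫ x : ℝ, (2 * (1 - x))⁻¹ ∂ν : ℝ) : ℂ) + ∫ x, L x ∂ν := by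
      rw [← integral_congr_ae hKL, integral_sub hK hint', ← hrep w hw, integral_complex_ofReal]
      ring
    rw [h1, hsplit, hIoo, hφ1]
    push_cast
    simp only [Complex.ofReal_re]
    ring

/-- This rules out the default zero triple. Uniqueness is not needed: the estimates hold for any
representing triple. -/
theorem IsNegCompleteBernstein.represents_reprTriple {φ : ℂ → ℂ} (hφ : IsNegCompleteBernstein φ) :
    (reprTriple φ).Represents φ := by
  rw [reprTriple, dif_pos hφ.exists_represents]
  exact hφ.exists_represents.choose_spec

end HirschCalculus

end

theorem proposition3p6 {X : Type*} [NormedAddCommGroup X] [NormedSpace ℂ X] [CompleteSpace X]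
    (I : HirschCalculus.OperatorIdeal X)
    (φ : ℂ → ℂ) (hφ : HirschCalculus.IsNegCompleteBernstein φ)
    (d : ℝ) (hd : HirschCalculus.HasDerivLimit φ d)
    (A B : X →ₗ.[ℂ] X)
    (hA : HirschCalculus.IsNonpositive A) (hB : HirschCalculus.IsNonpositive B)
    (hAB : A.domain ≤ B.domain)
    (K : I.carrier) (hK : HirschCalculus.IsBoundedExtension (A - B) (K : X →L[ℂ] X)) :
    ∃ S : I.carrier,
      HirschCalculus.IsBoundedExtension
        (HirschCalculus.opFun φ A hA - HirschCalculus.opFun φ B hB) (S : X →L[ℂ] X) ∧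
      I.idealNorm S ≤
        HirschCalculus.resolventBound A * HirschCalculus.resolventBound B * d *
          I.idealNorm K := by
  obtain ⟨hσ, hσd⟩ := (HirschCalculus.reprTriple φ).integrableOn_inv_of_hasDerivLimit
    hφ.represents_reprTriple hφ.differentiableOn hd
  refine ⟨HirschCalculus.differenceElement (HirschCalculus.reprTriple φ) A B I K, ?_, ?_⟩
  · exact HirschCalculus.isBoundedExtension_closure_sub
      (HirschCalculus.hirschCore_isClosable _ A hA) (HirschCalculus.hirschCore_isClosable _ B hB)
      hA.dense_domain hAB (HirschCalculus.hirschCore_sub _ hσ hA hB hAB I K hK)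
  · refine (HirschCalculus.norm_differenceElement_le _ hσ hA hB I K).trans ?_
    exact mul_le_mul_of_nonneg_right (mul_le_mul_of_nonneg_left hσd
      (mul_nonneg (HirschCalculus.IsNonpositive.resolventBound_nonneg A)
        (HirschCalculus.IsNonpositive.resolventBound_nonneg B))) (apply_nonneg I.idealNorm K)
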